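/- Let $d \in \mathbb{N}$ and let $\Omega \subset \mathbb{R}^d$ be a bounded connected open set. All function spaces are complex: for $1 \le s < \infty$, $W^{1,s}(\Omega)$ is the space of all $u \in L^s(\Omega)$ whose weak partial derivatives $\partial_1 u, \ldots, \partial_d u$ belong to $L^s(\Omega)$, with norm $\|u\|_{W^{1,s}} = (\|u\|_s^s + \sum_{j=1}^d \|\partial_j u\|_s^s)^{1/s}$, and $(W^{1,s}(\Omega))^*$ is the space of continuous antilinear functionals on it, with the operator norm. Let $r \in (2,\infty)$ and suppose that $W^{1,2}(\Omega) \subset L^r(\Omega)$. Let $\mu \colon \Omega \to \mathbb{R}^{d \times d}$ be bounded and measurable, and suppose that there is a $\nu > 0$ such that $$\operatorname{Re} \sum_{k,\ell=1}^d \mu_{k\ell}(x)\, \xi_k\, \overline{\xi_\ell} \ge \nu |\xi|^2 \quad \text{for all } \xi \in \mathbb{C}^d \text{ and almost all } x \in \Omega.$$ Define $\mathcal{A} \colon W^{1,2}(\Omega) \to (W^{1,2}(\Omega))^*$ by $$(\mathcal{A}u)(v) = \int_\Omega \mu \nabla u \cdot \overline{\nabla v}.$$ Let $q \in (d,\infty)$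 satisfy $\frac12 - \frac1q > \frac1r$, and let $p$ be the dual exponent of $q$, that is, $\frac1p + \frac1q = 1$. Then $q > 2 > p$, hence $W^{1,2}(\Omega) \subset W^{1,p}(\Omega)$; for $u \in W^{1,2}(\Omega)$ and $T \in (W^{1,p}(\Omega))^*$ we write $\mathcal{A}u = T$ if $(\mathcal{A}u)(v) = T(v)$ for all $v \in W^{1,2}(\Omega)$, and $\mathcal{A}u \in (W^{1,p}(\Omega))^*$ if there is such a $T$. (i) If $u \in W^{1,2}(\Omega)$ and $\mathcal{A}u \in (W^{1,p}(\Omega))^*$, then $u \in L^\infty(\Omega)$. (ii) For every $T \in (W^{1,p}(\Omega))^*$ with $T(\mathbf{1}) = 0$, where $\mathbf{1}$ is the constant function with value $1$, there is a unique $u \in W^{1,2}(\Omega)$ with $\int_\Omega u = 0$ and $\mathcal{A}u = T$. (iii) There is a $c > 0$ such that for every $T \in (W^{1,p}(\Omega))^*$ with $T(\mathbf{1}) = 0$ the solution $u$ in (ii) satisfies $\|u\|_{L^\infty(\Omega)} \le c\, \|T\|_{(W^{1,p}(\Omega))^*}$. -/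

import Mathlib

open MeasureTheory
open scoped ENNReal ContDiff ComplexConjugate

/-- `g` is the weak `j`-th partial derivative of `u` on the open set `Ω`: integration by parts holds
against every real smooth test function with compact support in `Ω`. -/
def HasWeakPartialDeriv {d : ℕ} (Ω : Set (EuclideanSpace ℝ (Fin d))) (j : Fin d)
    (u g : EuclideanSpace ℝ (Fin d) → ℂ) : Prop :=
  ∀ φ : EuclideanSpace ℝ (Fin d) → ℝ, ContDiff ℝ ∞ φ → HasCompactSupport φ → tsupport φ ⊆ Ω →
    ∫ x in Ω, (fderiv ℝ φ x (EuclideanSpace.single j 1)) • u x = - ∫ x in Ω, φ x • g x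

/-- Pairs of a scalar and a `d`-component complex `L^p` field on `Ω`, with the norm
`‖(u, g)‖ = (‖u‖_p ^ p + ∑ j, ‖g j‖_p ^ p) ^ (1 / p)` for finite `p`. -/
abbrev LpJet {d : ℕ} (Ω : Set (EuclideanSpace ℝ (Fin d))) (p : ℝ≥0∞) : Type :=
  WithLp p (Lp ℂ p (volume.restrict Ω) × PiLp p (fun _ : Fin d => Lp ℂ p (volume.restrict Ω)))

lemma integrable_test_smul {d : ℕ} {Ω : Set (EuclideanSpace ℝ (Fin d))} {p : ℝ≥0∞}
    [hp : Fact (1 ≤ p)] (u : Lp ℂ p (volume.restrict Ω)) {φ : EuclideanSpace ℝ (Fin d) → ℝ}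
    (hφ : Continuous φ) (hc : HasCompactSupport φ) :
    Integrable (fun x => φ x • u x) (volume.restrict Ω) :=
  ((Lp.memLp u).locallyIntegrable hp.out).integrable_smul_left_of_hasCompactSupport hφ hc

lemma test_fderiv {d : ℕ} {φ : EuclideanSpace ℝ (Fin d) → ℝ} (hφ : ContDiff ℝ ∞ φ)
    (hc : HasCompactSupport φ) (e : EuclideanSpace ℝ (Fin d)) :
    Continuous (fun x => fderiv ℝ φ x e) ∧ HasCompactSupport (fun x => fderiv ℝ φ x e) :=
  ⟨(hφ.continuous_fderiv (by simp)).clm_apply continuous_const, hc.fderiv_apply ℝ e⟩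

/-- The subspace of pairs `(u, g)` such that `g` is the weak gradient of `u`. -/
def sobolevW1Submodule {d : ℕ} (Ω : Set (EuclideanSpace ℝ (Fin d))) (p : ℝ≥0∞) [Fact (1 ≤ p)] :
    Submodule ℂ (LpJet Ω p) where
  carrier := {w | ∀ j, HasWeakPartialDeriv Ω j w.fst (w.snd j)}
  zero_mem' := by
    intro j φ _ _ _
    have h0 : ((0 : Lp ℂ p (volume.restrict Ω)) : EuclideanSpace ℝ (Fin d) → ℂ)
        =ᵐ[volume.restrict Ω] 0 := Lp.coeFn_zero ..
    have h1 : ∫ x in Ω, (fderiv ℝ φ x (EuclideanSpace.single j 1)) •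
        (0 : Lp ℂ p (volume.restrict Ω)) x = 0 :=
      integral_eq_zero_of_ae (by filter_upwards [h0] with x hx; simp only [Pi.zero_apply] at hx ⊢; rw [hx]; simp)
    have h2 : ∫ x in Ω, φ x • (0 : Lp ℂ p (volume.restrict Ω)) x = 0 :=
      integral_eq_zero_of_ae (by filter_upwards [h0] with x hx; simp only [Pi.zero_apply] at hx ⊢; rw [hx]; simp)
    exact h1.trans (by rw [← neg_zero, ← h2]; rfl)
  add_mem' := by
    intro v w hv hw j φ hφ hc hs
    obtain ⟨hd, hdc⟩ := test_fderiv hφ hc (EuclideanSpace.single j 1)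
    have h1 := integral_add (integrable_test_smul v.fst hd hdc)
      (integrable_test_smul w.fst hd hdc)
    have h2 := integral_add (integrable_test_smul (v.snd j) hφ.continuous hc)
      (integrable_test_smul (w.snd j) hφ.continuous hc)
    rw [hv j φ hφ hc hs, hw j φ hφ hc hs, ← neg_add, ← h2] at h1
    refine Eq.trans (integral_congr_ae ?_) (h1.trans (congrArg Neg.neg (integral_congr_ae ?_)))
    · filter_upwards [Lp.coeFn_add v.fst w.fst] with x hx
      have : ((v + w).fst : EuclideanSpace ℝ (Fin d) → ℂ) x = v.fst x + w.fst x := hx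
      rw [this, smul_add]
    · filter_upwards [Lp.coeFn_add (v.snd j) (w.snd j)] with x hx
      have : ((v + w).snd j : EuclideanSpace ℝ (Fin d) → ℂ) x = v.snd j x + w.snd j x := hx
      rw [this, smul_add]
  smul_mem' := by
    intro a w hw j φ hφ hc hs
    have h1 := congrArg (fun z => a • z) (hw j φ hφ hc hs)
    simp only [smul_neg, ← integral_smul] at h1
    refine Eq.trans (integral_congr_ae ?_) (h1.trans (congrArg Neg.neg (integral_congr_ae ?_)))
    · filter_upwards [Lp.coeFn_smul a w.fst] with x hx
      have : ((a • w).fst : EuclideanSpace ℝ (Fin d) → ℂ) x = a • w.fst x := hx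
      rw [this, smul_comm]
    · filter_upwards [Lp.coeFn_smul a (w.snd j)] with x hx
      have : ((a • w).snd j : EuclideanSpace ℝ (Fin d) → ℂ) x = a • w.snd j x := hx
      rw [this, smul_comm]

/-- The complex Sobolev space `W^{1,p}(Ω)`: its elements are the functions `u ∈ L^p(Ω)` whose weak
partial derivatives are all in `L^p(Ω)`, stored together with these derivatives (which are
determined by `u`, see `SobolevW1.fn_injective`). It carries the usual Sobolev norm
`(‖u‖_p ^ p + ∑ j, ‖∂_j u‖_p ^ p) ^ (1 / p)`. -/
abbrev SobolevW1 {d : ℕ} (Ω : Set (EuclideanSpace ℝ (Fin d))) (p : ℝ≥0∞) [Fact (1 ≤ p)] : Type :=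
  sobolevW1Submodule Ω p

namespace SobolevW1

variable {d : ℕ} {Ω : Set (EuclideanSpace ℝ (Fin d))} {p : ℝ≥0∞} [Fact (1 ≤ p)]

/-- The underlying `L^p` function. -/
def fn (u : SobolevW1 Ω p) : Lp ℂ p (volume.restrict Ω) := u.1.fst

/-- The weak partial derivatives. -/
def grad (u : SobolevW1 Ω p) (j : Fin d) : Lp ℂ p (volume.restrict Ω) := u.1.snd j

lemma hasWeakPartialDeriv (u : SobolevW1 Ω p) (j : Fin d) :
    HasWeakPartialDeriv Ω j u.fn (u.grad j) := u.2 j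

/-- An element of the Sobolev space is determined by its underlying function. -/
theorem fn_injective (hΩ : IsOpen Ω) : Function.Injective (fn : SobolevW1 Ω p → _) := by
  intro u v h
  have hg : ∀ j, u.grad j = v.grad j := by
    intro j
    have hli : ∀ w : SobolevW1 Ω p, LocallyIntegrable (w.grad j) (volume.restrict Ω) :=
      fun w => (Lp.memLp (w.grad j)).locallyIntegrable Fact.out
    have key : ∀ᵐ x ∂(volume : Measure (EuclideanSpace ℝ (Fin d))), x ∈ Ω →
        u.grad j x - v.grad j x = 0 := by
      refine hΩ.ae_eq_zero_of_integral_contDiff_smul_eq_zero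
        (f := fun x => u.grad j x - v.grad j x) ?_ ?_
      · exact (locallyIntegrableOn_of_locallyIntegrable_restrict
          ((hli u).sub (hli v)))
      · intro φ hφ hc hs
        have e1 := u.hasWeakPartialDeriv j φ hφ hc hs
        have e2 := v.hasWeakPartialDeriv j φ hφ hc hs
        rw [h] at e1
        have e3 := neg_injective (e1.symm.trans e2)
        have e4 : ∫ x, φ x • (u.grad j x - v.grad j x)
            = ∫ x in Ω, φ x • (u.grad j x - v.grad j x) := by
          refine (setIntegral_eq_integral_of_forall_compl_eq_zero fun x hx => ?_).symm
          rw [image_eq_zero_of_notMem_tsupport fun hx' => hx (hs hx'), zero_smul]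
        rw [e4]
        simp only [smul_sub]
        rw [integral_sub (integrable_test_smul _ hφ.continuous hc)
          (integrable_test_smul _ hφ.continuous hc), e3, sub_self]
    refine Lp.ext ?_
    filter_upwards [(ae_restrict_iff' hΩ.measurableSet).2 key] with x hx
    exact sub_eq_zero.1 hx
  apply Subtype.ext
  apply (WithLp.equiv p _).injective
  exact Prod.ext h (PiLp.ext hg)

/-- Build an element of the Sobolev space from representatives. -/
noncomputable def mk (u : EuclideanSpace ℝ (Fin d) → ℂ) (g : Fin d → EuclideanSpace ℝ (Fin d) → ℂ)
    (hu : MemLp u p (volume.restrict Ω)) (hg : ∀ j, MemLp (g j) p (volume.restrict Ω))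
    (h : ∀ j, HasWeakPartialDeriv Ω j u (g j)) : SobolevW1 Ω p :=
  ⟨WithLp.toLp p (hu.toLp u, WithLp.toLp p fun j => (hg j).toLp (g j)), by
    intro j φ hφ hc hs
    refine Eq.trans (integral_congr_ae ?_)
      ((h j φ hφ hc hs).trans (congrArg Neg.neg (integral_congr_ae ?_)))
    · filter_upwards [hu.coeFn_toLp] with x hx
      exact congrArg _ hx
    · filter_upwards [(hg j).coeFn_toLp] with x hx
      exact congrArg _ hx.symm⟩

/-- The inclusion `W^{1,s}(Ω) ⊆ W^{1,p}(Ω)` for `p ≤ s` and `Ω` of finite measure. -/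
noncomputable def incl {s : ℝ≥0∞} [Fact (1 ≤ s)] (hfin : volume Ω ≠ ⊤) (hps : p ≤ s) (u : SobolevW1 Ω s) :
    SobolevW1 Ω p :=
  haveI : IsFiniteMeasure (volume.restrict Ω) := isFiniteMeasure_restrict.2 hfin
  mk u.fn (fun j => u.grad j) ((Lp.memLp u.fn).mono_exponent hps)
    (fun j => (Lp.memLp (u.grad j)).mono_exponent hps) u.hasWeakPartialDeriv

/-- The constant function `1` as an element of `W^{1,p}(Ω)`, for `Ω` of finite measure. -/
noncomputable def one (hfin : volume Ω ≠ ⊤) : SobolevW1 Ω p :=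
  haveI : IsFiniteMeasure (volume.restrict Ω) := isFiniteMeasure_restrict.2 hfin
  mk (fun _ => 1) (fun _ _ => 0) (memLp_const 1) (fun _ => memLp_const 0) (by
    intro j φ hφ hc hs
    have h0 : ∫ x, fderiv ℝ φ x (EuclideanSpace.single j 1) = 0 := by
      obtain ⟨hd, hdc⟩ := test_fderiv hφ hc (EuclideanSpace.single j 1)
      have := integral_mul_fderiv_eq_neg_fderiv_mul_of_integrable (μ := volume)
        (f := fun _ : EuclideanSpace ℝ (Fin d) => (1 : ℝ)) (g := φ)
        (v := EuclideanSpace.single j 1) (by simp)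
        (by simpa using hd.integrable_of_hasCompactSupport hdc)
        (by simpa using hφ.continuous.integrable_of_hasCompactSupport hc)
        (fun x _ => by fun_prop) (fun x _ => hφ.differentiable (by simp) x)
      simpa using this
    have h1 : ∫ x in Ω, fderiv ℝ φ x (EuclideanSpace.single j 1) = 0 := by
      rw [← h0]
      refine setIntegral_eq_integral_of_forall_compl_eq_zero fun x hx => ?_
      rw [fderiv_of_notMem_tsupport (𝕜 := ℝ) fun hx' => hx (hs hx')]
      rfl
    rw [integral_smul_const, h1]
    simp)

end SobolevW1

/-- The continuous antidual `(W^{1,p}(Ω))^*`: bounded antilinear functionals on `W^{1,p}(Ω)`, with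
the operator norm. -/
abbrev SobolevDual {d : ℕ} (Ω : Set (EuclideanSpace ℝ (Fin d))) (p : ℝ≥0∞) [Fact (1 ≤ p)] : Type :=
  SobolevW1 Ω p →L⋆[ℂ] ℂ

/-- The sesquilinear form `𝒜(u, v) = ∫_Ω μ ∇u · conj (∇v)`. -/
noncomputable def neumannForm {d : ℕ} {Ω : Set (EuclideanSpace ℝ (Fin d))}
    (μ : EuclideanSpace ℝ (Fin d) → Matrix (Fin d) (Fin d) ℝ) (u v : SobolevW1 Ω 2) : ℂ :=
  ∫ x in Ω, ∑ k, (∑ l, (μ x k l : ℂ) * u.grad l x) * conj (v.grad k x)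

/-- `𝒜 u = T` for `T ∈ (W^{1,p}(Ω))^*`, `p ≤ 2`: the functional `𝒜 u` on `W^{1,2}(Ω)` is the
restriction of `T` to `W^{1,2}(Ω) ⊆ W^{1,p}(Ω)`. -/
def SolvesNeumann {d : ℕ} {Ω : Set (EuclideanSpace ℝ (Fin d))} {p : ℝ≥0∞} [Fact (1 ≤ p)]
    (hfin : volume Ω ≠ ⊤) (hp : p ≤ 2)
    (μ : EuclideanSpace ℝ (Fin d) → Matrix (Fin d) (Fin d) ℝ)
    (u : SobolevW1 Ω 2) (T : SobolevDual Ω p) : Prop :=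
  ∀ v : SobolevW1 Ω 2, neumannForm μ u v = T (SobolevW1.incl hfin hp v)

/-- Under the assumptions on `r` and `q` one has `q > 2`, so the dual exponent `p` is at most `2`. -/
lemma dualExponent_le_two {p q r : ℝ} (hr : 2 < r) (hpq : p.HolderConjugate q)
    (hqr : 1 / 2 - 1 / q > 1 / r) : ENNReal.ofReal p ≤ 2 := by
  have h1 : p⁻¹ + q⁻¹ = 1 := hpq.inv_add_inv_eq_one
  have h2 : 0 < 1 / r := by positivity
  have h3 : (1 : ℝ) / 2 < p⁻¹ := by
    rw [one_div q] at hqr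
    linarith
  have h4 : p < 2 := by
    have := (lt_inv_comm₀ (by norm_num) hpq.pos).1 h3
    simpa using this
  calc ENNReal.ofReal p ≤ ENNReal.ofReal 2 := ENNReal.ofReal_le_ofReal h4.le
    _ = 2 := by simp

/-! The supremum bound is Stampacchia's truncation argument. Test the equation with $v =
(\operatorname{Re} u - k)_+$. Since $\mu$ is real, $\operatorname{Re}(\mathcal{A}u)(v)$ controls
$\nu\|\nabla v\|_2^2$. Since $T$ lives on $W^{1,p}$ with $p < 2$ and $v$ vanishes off $A_k =
\{\operatorname{Re} u > k\}$, Hölder gives $|T(v)| \lesssim \|T\|\,|A_k|^{\beta}\|v\|_{W^{1,2}}$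
with $\beta = \frac1p - \frac12 = \frac12 - \frac1q$. For $k \ge k_0$ the set $A_k$ is so small that
the embedding into $L^r$ absorbs $\|v\|_2$ into the full norm, hence $\|v\|_{W^{1,2}} \lesssim
\|T\|\,|A_k|^\beta$. The embedding and Chebyshev then yield $(h-k)|A_h|^{1/r} \lesssim
\|T\|\,|A_k|^\beta$. As $\beta > \frac1r$, this is superlinear in $|A_k|^{1/r}$, and iteration gives
$|A_k| = 0$ at a level linear in $\|u\|_{W^{1,2}}$ and $\|T\|$ (`exists_ae_re_le`,
`eq_zero_of_stampacchia`). Rotating $u$ by $\pm1, \pm i$ bounds its modulus.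

Solvability rests on a Poincaré inequality $\|u\|^2 \le C(\|\nabla u\|_2^2 + |\int u|^2)$, proved
with neither boundary regularity nor compact embedding (`exists_norm_le_energy_add_integral`). It
holds on balls, spreads along the connected set $\Omega$ to compact subsets with one common constant
$c(u)$, and the embedding into $L^r$ makes the remaining piece of small measure absorbable. The form
plus $\int u\,\overline{\int v}$ is therefore coercive, and Lax–Milgram applies. Testing with
$\mathbf 1$ and using $T(\mathbf 1) = 0$ shows $\int u = 0$, so the extra term disappears.
Coercivity also gives uniqueness and $\|u\| \lesssim \|T\|$, which turns the supremum bound into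
(iii).

The weak derivative of a truncation comes from local mollification and a chain rule; the embedding
is bounded by the closed graph theorem. -/

open Filter Topology Set
open scoped Convolution

/-! ### Mollification in $L^2$ -/

section Mollification

/-- Jensen's inequality for the square and a density of total mass at most one. -/
lemma lintegral_mul_sq_le {α : Type*} [MeasurableSpace α] {m : Measure α} {ρ f : α → ℝ≥0∞}
    (hρ : AEMeasurable ρ m) (hρ1 : ∫⁻ x, ρ x ∂m ≤ 1) (hf : AEMeasurable f m) :
    (∫⁻ x, ρ x * f x ∂m) ^ 2 ≤ ∫⁻ x, ρ x * f x ^ 2 ∂m := by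
  -- Cauchy–Schwarz for the splitting $\rho f = \sqrt\rho \cdot \sqrt\rho f$.
  have h := ENNReal.lintegral_mul_le_Lp_mul_Lq m (p := 2) (q := 2)
    Real.HolderConjugate.two_two (f := fun x => ρ x ^ (1 / 2 : ℝ))
    (g := fun x => ρ x ^ (1 / 2 : ℝ) * f x) (hρ.pow_const _) ((hρ.pow_const _).mul hf)
  have e1 : ∀ x, (ρ x ^ (1 / 2 : ℝ)) ^ (2 : ℝ) = ρ x := fun x => by
    rw [← ENNReal.rpow_mul]; norm_num
  have e2 : ∀ x, ρ x ^ (1 / 2 : ℝ) * ρ x ^ (1 / 2 : ℝ) = ρ x := fun x => by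
    have := e1 x
    rwa [ENNReal.rpow_two, sq] at this
  simp only [Pi.mul_apply, ← mul_assoc, e2, e1, ENNReal.mul_rpow_of_nonneg _ _ zero_le_two] at h
  have h2 : (∫⁻ x, ρ x * f x ∂m) ≤ (∫⁻ x, ρ x * f x ^ (2 : ℝ) ∂m) ^ (1 / 2 : ℝ) :=
    h.trans (mul_le_of_le_one_left' (ENNReal.rpow_le_one hρ1 (by norm_num)))
  calc (∫⁻ x, ρ x * f x ∂m) ^ 2 ≤ ((∫⁻ x, ρ x * f x ^ (2 : ℝ) ∂m) ^ (1 / 2 : ℝ)) ^ 2 := by gcongr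
    _ = _ := by
      rw [← ENNReal.rpow_two, ← ENNReal.rpow_mul]
      norm_num

/-- On a finite measure space `L²` convergence to zero implies `L¹` convergence. -/
lemma tendsto_lintegral_of_tendsto_sq {α : Type*} [MeasurableSpace α] {m : Measure α}
    [IsFiniteMeasure m] {f : ℕ → α → ℝ≥0∞} (hf : ∀ n, AEMeasurable (f n) m)
    (h : Tendsto (fun n => ∫⁻ x, f n x ^ 2 ∂m) atTop (𝓝 0)) :
    Tendsto (fun n => ∫⁻ x, f n x ∂m) atTop (𝓝 0) := by
  have hle : ∀ n, ∫⁻ x, f n x ∂m ≤ m univ ^ (1 / 2 : ℝ) * (∫⁻ x, f n x ^ 2 ∂m) ^ (1 / 2 : ℝ) := by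
    intro n
    have := ENNReal.lintegral_mul_le_Lp_mul_Lq m (p := 2) (q := 2)
      Real.HolderConjugate.two_two (f := fun _ => 1) aemeasurable_const (hf n)
    simpa using this
  have h2 : Tendsto (fun n => m univ ^ (1 / 2 : ℝ) * (∫⁻ x, f n x ^ 2 ∂m) ^ (1 / 2 : ℝ)) atTop
      (𝓝 (m univ ^ (1 / 2 : ℝ) * 0 ^ (1 / 2 : ℝ))) :=
    ENNReal.Tendsto.const_mul ((ENNReal.continuous_rpow_const.tendsto _).comp h)
      (Or.inr (ENNReal.rpow_ne_top_of_nonneg (by norm_num) (measure_ne_top _ _)))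
  rw [ENNReal.zero_rpow_of_pos (by norm_num), mul_zero] at h2
  exact tendsto_of_tendsto_of_tendsto_of_le_of_le tendsto_const_nhds h2 (fun _ => zero_le) hle

/-- Almost everywhere convergence without increase of the `L²` norm implies `L²` convergence. -/
lemma tendsto_lintegral_enorm_sub_sq {α : Type*} [MeasurableSpace α] {m : Measure α}
    {f : ℕ → α → ℂ} {g : α → ℂ} (hf : ∀ n, AEStronglyMeasurable (f n) m)
    (hg : AEStronglyMeasurable g m) (hlim : ∀ᵐ x ∂m, Tendsto (fun n => f n x) atTop (𝓝 (g x)))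
    (hle : ∀ n, ∫⁻ x, ‖f n x‖ₑ ^ 2 ∂m ≤ ∫⁻ x, ‖g x‖ₑ ^ 2 ∂m) (hfin : ∫⁻ x, ‖g x‖ₑ ^ 2 ∂m ≠ ⊤) :
    Tendsto (fun n => ∫⁻ x, ‖f n x - g x‖ₑ ^ 2 ∂m) atTop (𝓝 0) := by
  set J := ∫⁻ x, ‖g x‖ₑ ^ 2 ∂m
  have en : ∀ z : ℂ, ‖z‖ₑ ^ 2 = ENNReal.ofReal (‖z‖ ^ 2) := fun z => by
    rw [ENNReal.ofReal_pow (norm_nonneg _), ofReal_norm]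
  have hpos : ∀ n x, 0 ≤ 2 * ‖f n x‖ ^ 2 + 2 * ‖g x‖ ^ 2 - ‖f n x - g x‖ ^ 2 := fun n x => by
    have := norm_sub_le (f n x) (g x)
    nlinarith [sq_nonneg (‖f n x‖ - ‖g x‖), norm_nonneg (f n x - g x)]
  -- Nonnegative by $|a-b|^2 \le 2|a|^2 + 2|b|^2$ and convergent a.e. to $4|g|^2$. Fatou gives $4J
  -- \le \liminf \int h_n$, while $\int h_n + \int |f_n - g|^2 \le 4J$; the second integral must
  -- vanish in the limit.
  set h : ℕ → α → ℝ≥0∞ := fun n x =>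
    ENNReal.ofReal (2 * ‖f n x‖ ^ 2 + 2 * ‖g x‖ ^ 2 - ‖f n x - g x‖ ^ 2) with hh
  have hmeas : ∀ n, AEMeasurable (h n) m := fun n => by
    have := (hf n).norm.aemeasurable
    have := hg.norm.aemeasurable
    have := ((hf n).sub hg).norm.aemeasurable
    simp only [Pi.sub_apply] at this
    fun_prop
  have hsum : ∀ n, (∫⁻ x, h n x ∂m) + ∫⁻ x, ‖f n x - g x‖ₑ ^ 2 ∂m ≤ 4 * J := fun n => by
    rw [← lintegral_add_left' (hmeas n)]
    calc _ = ∫⁻ x, (2 * ‖f n x‖ₑ ^ 2 + 2 * ‖g x‖ₑ ^ 2) ∂m := by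
          refine lintegral_congr fun x => ?_
          simp only [hh, en]
          rw [← ENNReal.ofReal_add (hpos n x) (by positivity),
            show (2 : ℝ≥0∞) = ENNReal.ofReal 2 by simp, ← ENNReal.ofReal_mul zero_le_two,
            ← ENNReal.ofReal_mul zero_le_two, ← ENNReal.ofReal_add (by positivity) (by positivity)]
          congr 1; ring
      _ = 2 * (∫⁻ x, ‖f n x‖ₑ ^ 2 ∂m) + 2 * J := by
          rw [lintegral_add_left' (((hf n).enorm.pow_const 2).const_mul 2),
            lintegral_const_mul' _ _ (by simp), lintegral_const_mul' _ _ (by simp)]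
      _ ≤ 2 * J + 2 * J := by gcongr; exact hle n
      _ = 4 * J := by ring
  have hfatou : 4 * J ≤ liminf (fun n => ∫⁻ x, h n x ∂m) atTop := by
    refine le_trans (le_of_eq ?_) (lintegral_liminf_le' hmeas)
    rw [← lintegral_const_mul' _ _ (by simp)]
    refine lintegral_congr_ae ?_
    filter_upwards [hlim] with x hx
    have : Tendsto (fun n => h n x) atTop
        (𝓝 (ENNReal.ofReal (2 * ‖g x‖ ^ 2 + 2 * ‖g x‖ ^ 2 - ‖g x - g x‖ ^ 2))) :=
      (ENNReal.continuous_ofReal.tendsto _).comp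
        ((((hx.norm.pow 2).const_mul 2).add_const _).sub ((hx.sub_const _).norm.pow 2))
    rw [this.liminf_eq, en, show (4 : ℝ≥0∞) = ENNReal.ofReal 4 by simp,
      ← ENNReal.ofReal_mul (by norm_num)]
    congr 1
    simp; ring
  rw [ENNReal.tendsto_nhds_zero]
  intro ε hε
  have h4 : 4 * J ≠ ⊤ := ENNReal.mul_ne_top (by simp) hfin
  rcases eq_or_ne (4 * J) 0 with h0 | h0
  · refine Eventually.of_forall fun n => ?_
    exact (le_add_self.trans (hsum n)).trans (h0.le.trans zero_le)
  have hlt : 4 * J - ε < liminf (fun n => ∫⁻ x, h n x ∂m) atTop :=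
    (ENNReal.sub_lt_self h4 h0 hε.ne').trans_le hfatou
  filter_upwards [eventually_lt_of_lt_liminf hlt] with n hn
  have h5 : (∫⁻ x, h n x ∂m) ≠ ⊤ := ne_top_of_le_ne_top h4 (le_self_add.trans (hsum n))
  calc _ ≤ 4 * J - ∫⁻ x, h n x ∂m := ENNReal.le_sub_of_add_le_left h5 (hsum n)
    _ ≤ ε := by
      rw [tsub_le_iff_right, add_comm, ← tsub_le_iff_right]
      exact hn.le

variable {E : Type*} [NormedAddCommGroup E] [InnerProductSpace ℝ E] [FiniteDimensional ℝ E]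
  [MeasurableSpace E] [BorelSpace E]

/-- Mollification does not increase the `L²` norm. -/
lemma lintegral_convolution_normed_sq_le (φ : ContDiffBump (0 : E)) {g : E → ℂ}
    (hg : AEStronglyMeasurable g) :
    ∫⁻ x, ‖(φ.normed volume ⋆[ContinuousLinearMap.lsmul ℝ ℝ, volume] g) x‖ₑ ^ 2
      ≤ ∫⁻ x, ‖g x‖ₑ ^ 2 := by
  set ρ : E → ℝ≥0∞ := fun t => ENNReal.ofReal (φ.normed volume t) with hρ
  have hρm : Measurable ρ := ENNReal.measurable_ofReal.comp φ.continuous_normed.measurable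
  have hρ1 : ∫⁻ t, ρ t = 1 := by
    rw [← ofReal_integral_eq_lintegral_ofReal φ.integrable_normed
      (Eventually.of_forall fun t => φ.nonneg_normed t), φ.integral_normed, ENNReal.ofReal_one]
  have hgx : ∀ x, AEStronglyMeasurable (fun t => g (x - t)) := fun x =>
    hg.comp_quasiMeasurePreserving (quasiMeasurePreserving_sub_left volume x)
  -- Jensen for the probability density $\rho$; Tonelli and translation invariance do the rest.
  have hpt : ∀ x, ‖(φ.normed volume ⋆[ContinuousLinearMap.lsmul ℝ ℝ, volume] g) x‖ₑ ^ 2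
      ≤ ∫⁻ t, ρ t * ‖g (x - t)‖ₑ ^ 2 := by
    intro x
    refine le_trans ?_ (lintegral_mul_sq_le hρm.aemeasurable hρ1.le (hgx x).enorm)
    gcongr
    rw [convolution_def]
    refine (enorm_integral_le_lintegral_enorm _).trans (lintegral_mono fun t => ?_)
    simp only [ContinuousLinearMap.lsmul_apply]
    rw [enorm_smul, hρ, Real.enorm_eq_ofReal (φ.nonneg_normed t)]
  have hm2 : AEMeasurable (fun z : E × E => ρ z.2 * ‖g (z.1 - z.2)‖ₑ ^ 2)
      (volume.prod volume) := by
    have : AEStronglyMeasurable (fun z : E × E => g (z.1 - z.2)) (volume.prod volume) :=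
      hg.comp_quasiMeasurePreserving (quasiMeasurePreserving_sub volume volume)
    exact (hρm.comp measurable_snd).aemeasurable.mul (this.enorm.pow_const 2)
  calc _ ≤ ∫⁻ x, ∫⁻ t, ρ t * ‖g (x - t)‖ₑ ^ 2 := lintegral_mono hpt
    _ = ∫⁻ t, ∫⁻ x, ρ t * ‖g (x - t)‖ₑ ^ 2 := lintegral_lintegral_swap hm2
    _ = ∫⁻ t, ρ t * ∫⁻ x, ‖g x‖ₑ ^ 2 := by
      refine lintegral_congr fun t => ?_
      rw [lintegral_const_mul' _ _ (by simp [hρ]),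
        lintegral_sub_right_eq_self (fun x => ‖g x‖ₑ ^ 2) t]
    _ = _ := by rw [lintegral_mul_const _ hρm, hρ1, one_mul]

end Mollification

/-! ### Local smooth approximation -/

/-- Locally, mollification commutes with weak derivatives. -/
lemma HasWeakPartialDeriv.fderiv_mollify {d : ℕ} {Ω : Set (EuclideanSpace ℝ (Fin d))}
    (hΩ : IsOpen Ω) {j : Fin d} {u g : EuclideanSpace ℝ (Fin d) → ℂ}
    (h : HasWeakPartialDeriv Ω j u g)
    (hu : LocallyIntegrable (Ω.indicator u)) (φ : ContDiffBump (0 : EuclideanSpace ℝ (Fin d)))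
    {x : EuclideanSpace ℝ (Fin d)} (hx : Metric.closedBall x φ.rOut ⊆ Ω) :
    fderiv ℝ (φ.normed volume ⋆[ContinuousLinearMap.lsmul ℝ ℝ, volume] Ω.indicator u) x
      (EuclideanSpace.single j 1) =
    (φ.normed volume ⋆[ContinuousLinearMap.lsmul ℝ ℝ, volume] Ω.indicator g) x := by
  have hcs := φ.hasCompactSupport_normed (μ := volume)
  have hsm : ContDiff ℝ ∞ (φ.normed volume) := φ.contDiff_normed
  have hd := (hcs.hasFDerivAt_convolution_left (ContinuousLinearMap.lsmul ℝ ℝ)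
    (hsm.of_le (by norm_num)) hu x).fderiv
  have hex := hcs.fderiv (𝕜 := ℝ) |>.convolutionExists_left
    (L := ContinuousLinearMap.precompL (EuclideanSpace ℝ (Fin d))
      (ContinuousLinearMap.lsmul ℝ ℝ : ℝ →L[ℝ] ℂ →L[ℝ] ℂ))
    (hsm.continuous_fderiv (by simp)) hu x
  set e : EuclideanSpace ℝ (Fin d) := EuclideanSpace.single j 1
  -- The reflected and translated bump is the test function. The sign from the reflection cancels
  -- the sign in the integration by parts.
  set ψ : EuclideanSpace ℝ (Fin d) → ℝ := fun y => φ.normed volume (x - y) with hψ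
  have hψs : ContDiff ℝ ∞ ψ := hsm.comp (contDiff_const.sub contDiff_id)
  have hψt : tsupport ψ ⊆ Metric.closedBall x φ.rOut := by
    refine closure_minimal (fun y hy => ?_) Metric.isClosed_closedBall
    have : x - y ∈ Function.support (φ.normed volume) := hy
    rw [φ.support_normed_eq, mem_ball_zero_iff] at this
    rw [Metric.mem_closedBall, dist_comm, dist_eq_norm]
    exact this.le
  have hψc : HasCompactSupport ψ :=
    (isCompact_closedBall x φ.rOut).of_isClosed_subset (isClosed_tsupport _) hψt
  have hψd : ∀ y, fderiv ℝ ψ y e = - fderiv ℝ (φ.normed volume) (x - y) e := by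
    intro y
    have h1 := (hsm.differentiable (by simp) (x - y)).hasFDerivAt
    have h2 : HasFDerivAt (fun y : EuclideanSpace ℝ (Fin d) => x - y)
        (-ContinuousLinearMap.id ℝ _) y := (hasFDerivAt_id y).const_sub x
    have h3 : HasFDerivAt ψ _ y := h1.comp y h2
    rw [h3.fderiv]
    simp
  have key : ∫ y in Ω, fderiv ℝ ψ y e • u y = -∫ y in Ω, ψ y • g y := h ψ hψs hψc (hψt.trans hx)
  simp only [hψd] at key
  have hind : ∀ (a : EuclideanSpace ℝ (Fin d) → ℝ) (f : EuclideanSpace ℝ (Fin d) → ℂ),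
      ∫ y, a y • Ω.indicator f y = ∫ y in Ω, a y • f y := by
    intro a f
    rw [← integral_indicator hΩ.measurableSet]
    congr 1; ext y
    by_cases hy : y ∈ Ω <;> simp [hy]
  rw [hd, convolution_eq_swap, convolution_eq_swap, ContinuousLinearMap.integral_apply]
  · simp only [ContinuousLinearMap.precompL_apply, ContinuousLinearMap.lsmul_apply]
    rw [hind (fun y => fderiv ℝ (φ.normed volume) (x - y) e), hind ψ g,
      ← neg_inj, ← key, ← integral_neg]
    simp only [neg_smul]
  · exact hex.integrable_swap

/-- Functions in `W^{1,2}(Ω)` are locally limits of smooth functions. -/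
theorem exists_smooth_approx {d : ℕ} {Ω : Set (EuclideanSpace ℝ (Fin d))}
    (hΩ : IsOpen Ω) {u : EuclideanSpace ℝ (Fin d) → ℂ} {g : Fin d → EuclideanSpace ℝ (Fin d) → ℂ}
    (hu : MemLp u 2 (volume.restrict Ω)) (hg : ∀ j, MemLp (g j) 2 (volume.restrict Ω))
    (h : ∀ j, HasWeakPartialDeriv Ω j u (g j)) {K : Set (EuclideanSpace ℝ (Fin d))}
    (hK : IsCompact K) (hKΩ : K ⊆ Ω) :
    ∃ w : ℕ → EuclideanSpace ℝ (Fin d) → ℂ, (∀ n, ContDiff ℝ ∞ (w n)) ∧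
      (∀ᵐ x ∂volume.restrict Ω, Tendsto (fun n => w n x) atTop (𝓝 (u x))) ∧
      Tendsto (fun n => ∫⁻ x in K, ‖w n x - u x‖ₑ) atTop (𝓝 0) ∧
      ∀ j, (∀ n, ∫⁻ x in K, ‖fderiv ℝ (w n) x (EuclideanSpace.single j 1)‖ₑ ^ 2
          ≤ ∫⁻ x in Ω, ‖g j x‖ₑ ^ 2) ∧
        Tendsto (fun n => ∫⁻ x in K, ‖fderiv ℝ (w n) x (EuclideanSpace.single j 1) - g j x‖ₑ)
          atTop (𝓝 0) := by
  -- Bumps of radius at most $\delta$ around points of $K$ stay inside $\Omega$, so extension by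
  -- zero does not affect the weak derivative there.
  obtain ⟨δ, hδ, hδK⟩ := hK.exists_cthickening_subset_open hΩ hKΩ
  -- The outer radius is twice the inner one: a bounded ratio is what a.e. convergence of the
  -- mollifications requires.
  let φ : ℕ → ContDiffBump (0 : EuclideanSpace ℝ (Fin d)) := fun n =>
    ⟨δ / (2 * (n + 1)), δ / (n + 1), by positivity, by
      rw [div_lt_div_iff_of_pos_left hδ (by positivity) (by positivity)]
      have : (0 : ℝ) < n + 1 := by positivity
      linarith⟩
  have hφ0 : Tendsto (fun n => (φ n).rOut) atTop (𝓝 0) :=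
    tendsto_const_div_atTop_nhds_zero_nat δ |>.comp (tendsto_add_atTop_nat 1) |>.congr fun n => by
      simp [φ]
  have hφK : ∀ᶠ n in atTop, (φ n).rOut ≤ 2 * (φ n).rIn := Eventually.of_forall fun n => by
    simp only [φ]
    apply le_of_eq
    field_simp
  have hφδ : ∀ n, (φ n).rOut ≤ δ := fun n => by
    simp only [φ]
    exact div_le_self hδ.le (by simp)
  have hext : ∀ f : EuclideanSpace ℝ (Fin d) → ℂ, MemLp f 2 (volume.restrict Ω) →
      MemLp (Ω.indicator f) 2 := fun f hf => (memLp_indicator_iff_restrict hΩ.measurableSet).2 hf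
  have hli : ∀ f : EuclideanSpace ℝ (Fin d) → ℂ, MemLp f 2 (volume.restrict Ω) →
      LocallyIntegrable (Ω.indicator f) := fun f hf => (hext f hf).locallyIntegrable one_le_two
  let M : (EuclideanSpace ℝ (Fin d) → ℂ) → ℕ → EuclideanSpace ℝ (Fin d) → ℂ := fun f n =>
    ((φ n).normed volume ⋆[ContinuousLinearMap.lsmul ℝ ℝ, volume] Ω.indicator f)
  have hMs : ∀ f, MemLp f 2 (volume.restrict Ω) → ∀ n, ContDiff ℝ ∞ (M f n) := fun f hf n =>
    (φ n).hasCompactSupport_normed.contDiff_convolution_left _ (φ n).contDiff_normed (hli f hf)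
  have hMae : ∀ f, MemLp f 2 (volume.restrict Ω) →
      ∀ᵐ x, Tendsto (fun n => M f n x) atTop (𝓝 (Ω.indicator f x)) := fun f hf =>
    ContDiffBump.ae_convolution_tendsto_right_of_locallyIntegrable hφ0 hφK (hli f hf)
  have hMd : ∀ j n, ∀ x ∈ K, fderiv ℝ (M u n) x (EuclideanSpace.single j 1) = M (g j) n x := by
    intro j n x hx
    refine (h j).fderiv_mollify hΩ (hli u hu) (φ n) (subset_trans ?_ hδK)
    exact (Metric.closedBall_subset_closedBall (hφδ n)).trans
      (Metric.closedBall_subset_cthickening hx δ)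
  have hind : ∀ f : EuclideanSpace ℝ (Fin d) → ℂ,
      ∫⁻ x, ‖Ω.indicator f x‖ₑ ^ 2 = ∫⁻ x in Ω, ‖f x‖ₑ ^ 2 := by
    intro f
    rw [← lintegral_indicator hΩ.measurableSet]
    refine lintegral_congr fun y => ?_
    by_cases hy : y ∈ Ω <;> simp [hy]
  have : IsFiniteMeasure (volume.restrict K) := isFiniteMeasure_restrict.2 hK.measure_lt_top.ne
  have hL1 : ∀ f, MemLp f 2 (volume.restrict Ω) →
      Tendsto (fun n => ∫⁻ x in K, ‖M f n x - f x‖ₑ) atTop (𝓝 0) := by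
    intro f hf
    have := tendsto_lintegral_enorm_sub_sq (m := volume) (f := M f)
      (fun n => (hMs f hf n).continuous.aestronglyMeasurable) (hext f hf).1
      (hMae f hf) (fun n => lintegral_convolution_normed_sq_le (φ n) (hext f hf).1) (by
        have := (hext f hf).2
        rw [eLpNorm_lt_top_iff_lintegral_rpow_enorm_lt_top (by simp) (by simp)] at this
        simpa using this.ne)
    refine tendsto_lintegral_of_tendsto_sq (fun n => ?_) ?_
    · exact ((hMs f hf n).continuous.aestronglyMeasurable.sub
        (hf.1.mono_measure (Measure.restrict_mono hKΩ le_rfl))).enorm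
    refine tendsto_of_tendsto_of_tendsto_of_le_of_le tendsto_const_nhds this
      (fun _ => zero_le) fun n => ?_
    dsimp only
    rw [setLIntegral_congr_fun hK.measurableSet (g := fun x => ‖M f n x - Ω.indicator f x‖ₑ ^ 2)
      fun x hx => by simp only []; rw [indicator_of_mem (hKΩ hx)]]
    exact setLIntegral_le_lintegral _ _
  refine ⟨M u, hMs u hu, ?_, hL1 u hu, fun j => ⟨fun n => ?_, ?_⟩⟩
  · rw [ae_restrict_iff' hΩ.measurableSet]
    filter_upwards [hMae u hu] with x hx hxΩ
    rwa [indicator_of_mem hxΩ] at hx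
  · rw [setLIntegral_congr_fun hK.measurableSet fun x hx => by rw [hMd j n x hx]]
    refine (setLIntegral_le_lintegral _ _).trans ?_
    rw [← hind]
    exact lintegral_convolution_normed_sq_le (φ n) (hext _ (hg j)).1
  · refine (hL1 (g j) (hg j)).congr fun n => ?_
    exact setLIntegral_congr_fun hK.measurableSet fun x hx => by rw [hMd j n x hx]

/-! ### Chain rule for weak derivatives -/

section ChainRule

variable {d : ℕ} {Ω : Set (EuclideanSpace ℝ (Fin d))}

lemma setIntegral_test_smul_ofReal {φ : EuclideanSpace ℝ (Fin d) → ℝ}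
    {K : Set (EuclideanSpace ℝ (Fin d))} (hKΩ : K ⊆ Ω)
    (hφ : ∀ x ∉ K, φ x = 0) (f : EuclideanSpace ℝ (Fin d) → ℝ) :
    ∫ x in Ω, φ x • (f x : ℂ) = ((∫ x in K, φ x * f x : ℝ) : ℂ) := by
  have e : ∀ x, φ x • (f x : ℂ) = ((φ x * f x : ℝ) : ℂ) := fun x => by simp
  simp only [e]
  rw [integral_complex_ofReal,
    setIntegral_eq_integral_of_forall_compl_eq_zero fun x hx => by
      rw [hφ x fun h => hx (hKΩ h), zero_mul],
    setIntegral_eq_integral_of_forall_compl_eq_zero fun x hx => by rw [hφ x hx, zero_mul]]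

/-- Chain rule for a continuously differentiable function of the real part. -/
theorem hasWeakPartialDeriv_comp_re (hΩ : IsOpen Ω) {u : EuclideanSpace ℝ (Fin d) → ℂ}
    {g : Fin d → EuclideanSpace ℝ (Fin d) → ℂ}
    (hu : MemLp u 2 (volume.restrict Ω)) (hg : ∀ j, MemLp (g j) 2 (volume.restrict Ω))
    (h : ∀ j, HasWeakPartialDeriv Ω j u (g j)) {F F' : ℝ → ℝ}
    (hF : ∀ t, HasDerivAt F (F' t) t) (hF'c : Continuous F') (hF'1 : ∀ t, |F' t| ≤ 1)
    (j : Fin d) :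
    HasWeakPartialDeriv Ω j (fun x => (F (u x).re : ℂ))
      (fun x => ((F' (u x).re * (g j x).re : ℝ) : ℂ)) := by
  intro φ hφ hc hs
  set e : EuclideanSpace ℝ (Fin d) := EuclideanSpace.single j 1
  set K := tsupport φ with hKdef
  have hK : IsCompact K := hc
  obtain ⟨hd, hdc⟩ := test_fderiv hφ hc e
  have hφK : ∀ x ∉ K, φ x = 0 := fun x hx => image_eq_zero_of_notMem_tsupport hx
  have hdK : ∀ x ∉ K, fderiv ℝ φ x e = 0 := fun x hx => by
    rw [fderiv_of_notMem_tsupport (𝕜 := ℝ) hx]; rfl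
  rw [setIntegral_test_smul_ofReal hs hdK, setIntegral_test_smul_ofReal hs hφK,
    ← Complex.ofReal_neg]
  congr 1
  have : IsFiniteMeasure (volume.restrict K) := isFiniteMeasure_restrict.2 hK.measure_lt_top.ne
  have huK := hu.mono_measure (Measure.restrict_mono hs le_rfl)
  have hgK := (hg j).mono_measure (Measure.restrict_mono hs le_rfl)
  have huK1 := huK.integrable one_le_two
  have hgK1 := hgK.integrable one_le_two
  have hFc : Continuous F := continuous_iff_continuousAt.2 fun t => (hF t).continuousAt
  have hLip : ∀ s t, |F s - F t| ≤ |s - t| := fun s t => by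
    simpa using Convex.norm_image_sub_le_of_norm_hasDerivWithin_le
      (fun x _ => (hF x).hasDerivWithinAt) (fun x _ => hF'1 x) convex_univ (mem_univ t) (mem_univ s)
  obtain ⟨w, hws, hwae, hwL, hwj⟩ := exists_smooth_approx hΩ hu hg h hK hs
  have hgL := (hwj j).2
  have hwaeK : ∀ᵐ x ∂volume.restrict K, Tendsto (fun n => w n x) atTop (𝓝 (u x)) :=
    ae_mono (Measure.restrict_mono hs le_rfl) hwae
  have hwre : ∀ n, ContDiff ℝ ∞ (fun x => (w n x).re) := fun n =>
    Complex.reCLM.contDiff.comp (hws n)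
  have hwred : ∀ n x, HasFDerivAt (fun x => (w n x).re)
      (Complex.reCLM.comp (fderiv ℝ (w n) x)) x := fun n x =>
    Complex.reCLM.hasFDerivAt.comp x ((hws n).differentiable (by simp) x).hasFDerivAt
  have hdc1 : ∀ n, Continuous fun x => fderiv ℝ (w n) x e := fun n =>
    ((hws n).continuous_fderiv (by simp)).clm_apply continuous_const
  -- Classical integration by parts for the smooth approximants; both sides then converge.
  have hparts : ∀ n, ∫ x in K, fderiv ℝ φ x e * F (w n x).re
      = -∫ x in K, φ x * (F' (w n x).re * (fderiv ℝ (w n) x e).re) := by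
    intro n
    have hv : ∀ x, HasFDerivAt (fun x => F (w n x).re)
        (F' (w n x).re • Complex.reCLM.comp (fderiv ℝ (w n) x)) x := fun x =>
      (hF _).comp_hasFDerivAt x (hwred n x)
    have hc1 : Continuous fun x => F' (w n x).re * (fderiv ℝ (w n) x e).re :=
      (hF'c.comp (hwre n).continuous).mul (Complex.continuous_re.comp (hdc1 n))
    have hc2 : Continuous fun x => F (w n x).re := hFc.comp (hwre n).continuous
    have hvd : ∀ x, fderiv ℝ (fun x => F (w n x).re) x e
        = F' (w n x).re * (fderiv ℝ (w n) x e).re := fun x => by rw [(hv x).fderiv]; rfl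
    have := integral_mul_fderiv_eq_neg_fderiv_mul_of_integrable (μ := volume)
      (f := φ) (g := fun x => F (w n x).re) (v := e)
      ((hd.mul hc2).integrable_of_hasCompactSupport hdc.mul_right)
      (by simp only [hvd]
          exact (hφ.continuous.mul hc1).integrable_of_hasCompactSupport hc.mul_right)
      ((hφ.continuous.mul hc2).integrable_of_hasCompactSupport hc.mul_right)
      (fun x _ => hφ.differentiable (by simp) x) (fun x _ => (hv x).differentiableAt)
    simp only [hvd] at this
    rw [setIntegral_eq_integral_of_forall_compl_eq_zero fun x hx => by rw [hdK x hx, zero_mul],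
      setIntegral_eq_integral_of_forall_compl_eq_zero fun x hx => by rw [hφK x hx, zero_mul],
      this, neg_neg]
  obtain ⟨A, hA⟩ := hd.bounded_above_of_compact_support hdc
  obtain ⟨B, hB⟩ := hφ.continuous.bounded_above_of_compact_support hc
  have hA0 : 0 ≤ A := (norm_nonneg _).trans (hA 0)
  have hB0 : 0 ≤ B := (norm_nonneg _).trans (hB 0)
  have hum := huK.1
  have hgm := hgK.1
  have L1 : Tendsto (fun n => ∫ x in K, fderiv ℝ φ x e * F (w n x).re) atTop
      (𝓝 (∫ x in K, fderiv ℝ φ x e * F (u x).re)) := by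
    refine tendsto_integral_of_L1 _ ?_ (Eventually.of_forall fun n => ?_) ?_
    · exact hd.aestronglyMeasurable.mul (hFc.comp_aestronglyMeasurable
        (Complex.continuous_re.comp_aestronglyMeasurable hum))
    · exact (hd.mul (hFc.comp (hwre n).continuous)).continuousOn.integrableOn_compact hK
    · have h2 : Tendsto (fun n => ENNReal.ofReal A * ∫⁻ x in K, ‖w n x - u x‖ₑ) atTop (𝓝 0) := by
        simpa using ENNReal.Tendsto.const_mul hwL (Or.inr ENNReal.ofReal_ne_top)
      refine tendsto_of_tendsto_of_tendsto_of_le_of_le tendsto_const_nhds h2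
        (fun _ => zero_le) fun n => ?_
      dsimp only
      rw [← lintegral_const_mul' _ _ ENNReal.ofReal_ne_top]
      refine lintegral_mono fun x => ?_
      rw [← ofReal_norm, ← ofReal_norm, ← ENNReal.ofReal_mul hA0, ← mul_sub, norm_mul]
      refine ENNReal.ofReal_le_ofReal (mul_le_mul (hA x) ?_ (norm_nonneg _) hA0)
      exact (hLip _ _).trans (by rw [← Complex.sub_re]; exact Complex.abs_re_le_norm _)
  have L2 : Tendsto (fun n => ∫ x in K, φ x * (F' (w n x).re * (fderiv ℝ (w n) x e).re)) atTop
      (𝓝 (∫ x in K, φ x * (F' (u x).re * (g j x).re))) := by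
    have hFum : AEStronglyMeasurable (fun x => F' (u x).re) (volume.restrict K) :=
      hF'c.comp_aestronglyMeasurable (Complex.continuous_re.comp_aestronglyMeasurable hum)
    refine tendsto_integral_of_L1 _ ?_ (Eventually.of_forall fun n => ?_) ?_
    · exact hφ.continuous.aestronglyMeasurable.mul
        (hFum.mul (Complex.continuous_re.comp_aestronglyMeasurable hgm))
    · exact (hφ.continuous.mul ((hF'c.comp (hwre n).continuous).mul
        (Complex.continuous_re.comp (hdc1 n)))).continuousOn.integrableOn_compact hK
    · have hDm : ∀ n, AEMeasurable (fun x => ‖(F' (w n x).re - F' (u x).re) * (g j x).re‖ₑ)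
          (volume.restrict K) := fun n =>
        (((hF'c.comp (hwre n).continuous).aestronglyMeasurable.sub hFum).mul
          (Complex.continuous_re.comp_aestronglyMeasurable hgm)).enorm
      -- $F'$ is only continuous and bounded, so this part uses a.e. convergence of $w_n$ with
      -- majorant $2|\partial_j u|$. The complementary part $F'(\operatorname{Re} w_n)(\partial_j
      -- w_n - \partial_j u)$ is small in $L^1$.
      have hD : Tendsto (fun n => ∫⁻ x in K, ‖(F' (w n x).re - F' (u x).re) * (g j x).re‖ₑ)
          atTop (𝓝 (∫⁻ _ in K, 0)) := by
        refine tendsto_lintegral_of_dominated_convergence' (fun x => 2 * ‖g j x‖ₑ) hDm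
          (fun n => Eventually.of_forall fun x => ?_) ?_ ?_
        · dsimp only
          rw [enorm_mul]
          gcongr
          · rw [← ofReal_norm, show (2 : ℝ≥0∞) = ENNReal.ofReal 2 by simp]
            refine ENNReal.ofReal_le_ofReal ((norm_sub_le _ _).trans ?_)
            have h1 := hF'1 (w n x).re
            have h2 := hF'1 (u x).re
            simp only [Real.norm_eq_abs]
            linarith
          · rw [← ofReal_norm, ← ofReal_norm]
            exact ENNReal.ofReal_le_ofReal (Complex.abs_re_le_norm _)
        · rw [lintegral_const_mul' _ _ (by simp)]
          exact ENNReal.mul_ne_top (by simp) hgK1.2.ne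
        · filter_upwards [hwaeK] with x hx
          have h3 : Tendsto (fun n => (F' (w n x).re - F' (u x).re) * (g j x).re) atTop
              (𝓝 ((F' (u x).re - F' (u x).re) * (g j x).re)) :=
            ((((hF'c.comp Complex.continuous_re).tendsto _).comp hx).sub_const _).mul_const _
          simpa using h3.enorm
      rw [lintegral_zero] at hD
      have h2 : Tendsto (fun n => ENNReal.ofReal B *
          ((∫⁻ x in K, ‖fderiv ℝ (w n) x e - g j x‖ₑ) +
            ∫⁻ x in K, ‖(F' (w n x).re - F' (u x).re) * (g j x).re‖ₑ)) atTop (𝓝 0) := by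
        simpa using ENNReal.Tendsto.const_mul (hgL.add hD) (Or.inr ENNReal.ofReal_ne_top)
      refine tendsto_of_tendsto_of_tendsto_of_le_of_le tendsto_const_nhds h2
        (fun _ => zero_le) fun n => ?_
      dsimp only
      rw [← lintegral_add_right' _ (hDm n), ← lintegral_const_mul' _ _ ENNReal.ofReal_ne_top]
      refine lintegral_mono fun x => ?_
      simp only [← ofReal_norm]
      rw [← ENNReal.ofReal_add (norm_nonneg _) (norm_nonneg _), ← ENNReal.ofReal_mul hB0,
        ← mul_sub, norm_mul]
      refine ENNReal.ofReal_le_ofReal (mul_le_mul (hB x) ?_ (norm_nonneg _) hB0)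
      rw [show F' (w n x).re * (fderiv ℝ (w n) x e).re - F' (u x).re * (g j x).re
        = F' (w n x).re * (fderiv ℝ (w n) x e - g j x).re
          + (F' (w n x).re - F' (u x).re) * (g j x).re by rw [Complex.sub_re]; ring]
      refine (norm_add_le _ _).trans (add_le_add_left ?_ _)
      rw [norm_mul]
      exact (mul_le_of_le_one_left (norm_nonneg _) (hF'1 _)).trans (Complex.abs_re_le_norm _)
  exact tendsto_nhds_unique (L1.congr hparts) L2.neg

/-- The chain rule passes to pointwise limits with uniform bounds. -/
theorem hasWeakPartialDeriv_comp_re_of_tendsto (hΩ : IsOpen Ω) {u : EuclideanSpace ℝ (Fin d) → ℂ}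
    {g : Fin d → EuclideanSpace ℝ (Fin d) → ℂ}
    (hu : MemLp u 2 (volume.restrict Ω)) (hg : ∀ j, MemLp (g j) 2 (volume.restrict Ω))
    (h : ∀ j, HasWeakPartialDeriv Ω j u (g j)) {F F' : ℕ → ℝ → ℝ} {G G' : ℝ → ℝ}
    (hF : ∀ n t, HasDerivAt (F n) (F' n t) t) (hF'c : ∀ n, Continuous (F' n))
    (hF1 : ∀ n t, |F n t| ≤ |t|)
    (hF'1 : ∀ n t, |F' n t| ≤ 1) (hFG : ∀ t, Tendsto (fun n => F n t) atTop (𝓝 (G t)))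
    (hFG' : ∀ t, Tendsto (fun n => F' n t) atTop (𝓝 (G' t))) (j : Fin d) :
    HasWeakPartialDeriv Ω j (fun x => (G (u x).re : ℂ))
      (fun x => ((G' (u x).re * (g j x).re : ℝ) : ℂ)) := by
  intro φ hφ hc hs
  obtain ⟨hd, hdc⟩ := test_fderiv hφ hc (EuclideanSpace.single j 1)
  have hum := Complex.continuous_re.comp_aestronglyMeasurable hu.1
  have hgm := Complex.continuous_re.comp_aestronglyMeasurable (hg j).1
  have L1 : Tendsto (fun n => ∫ x in Ω, (fderiv ℝ φ x (EuclideanSpace.single j 1)) •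
      (F n (u x).re : ℂ)) atTop
      (𝓝 (∫ x in Ω, (fderiv ℝ φ x (EuclideanSpace.single j 1)) • (G (u x).re : ℂ))) := by
    refine tendsto_integral_of_dominated_convergence
      (fun x => ‖fderiv ℝ φ x (EuclideanSpace.single j 1) • u x‖) (fun n => ?_) ?_
      (fun n => Eventually.of_forall fun x => ?_) (Eventually.of_forall fun x => ?_)
    · have hFc : Continuous (F n) := continuous_iff_continuousAt.2 fun t => (hF n t).continuousAt
      exact hd.aestronglyMeasurable.smul
        ((Complex.continuous_ofReal.comp hFc).comp_aestronglyMeasurable hum)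
    · exact ((hu.locallyIntegrable one_le_two).integrable_smul_left_of_hasCompactSupport hd hdc).norm
    · rw [norm_smul, norm_smul]
      gcongr
      rw [Complex.norm_real]
      exact (hF1 n _).trans (Complex.abs_re_le_norm _)
    · exact ((Complex.continuous_ofReal.tendsto _).comp (hFG _)).const_smul _
  have L2 : Tendsto (fun n => ∫ x in Ω, φ x • ((F' n (u x).re * (g j x).re : ℝ) : ℂ)) atTop
      (𝓝 (∫ x in Ω, φ x • ((G' (u x).re * (g j x).re : ℝ) : ℂ))) := by
    refine tendsto_integral_of_dominated_convergence
      (fun x => ‖φ x • g j x‖) (fun n => ?_) ?_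
      (fun n => Eventually.of_forall fun x => ?_) (Eventually.of_forall fun x => ?_)
    · exact hφ.continuous.aestronglyMeasurable.smul (Complex.continuous_ofReal.comp_aestronglyMeasurable
        (((hF'c n).comp_aestronglyMeasurable hum).mul hgm))
    · exact (((hg j).locallyIntegrable one_le_two).integrable_smul_left_of_hasCompactSupport
        hφ.continuous hc).norm
    · rw [norm_smul, norm_smul]
      gcongr
      rw [Complex.norm_real, norm_mul]
      exact (mul_le_of_le_one_left (norm_nonneg _) (hF'1 n _)).trans (Complex.abs_re_le_norm _)
    · exact ((Complex.continuous_ofReal.tendsto _).comp ((hFG' _).mul_const _)).const_smul _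
  exact tendsto_nhds_unique (L1.congr fun n => hasWeakPartialDeriv_comp_re hΩ hu hg h (hF n)
    (hF'c n) (hF'1 n) j φ hφ hc hs) L2.neg

end ChainRule

/-! ### Truncations of Sobolev functions -/

section Truncation

/-- Off `0` the formula is elementary, and a continuous function whose derivative extends
continuously to a point is differentiable there. -/
lemma hasDerivAt_max_zero_sq (t : ℝ) : HasDerivAt (fun s : ℝ => max s 0 ^ 2) (2 * max t 0) t := by
  have hne : ∀ y : ℝ, y ≠ 0 → HasDerivAt (fun s : ℝ => max s 0 ^ 2) (2 * max y 0) y := by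
    intro y hy
    rcases lt_or_gt_of_ne hy with h | h
    · have : HasDerivAt (fun _ : ℝ => (0 : ℝ)) (2 * max y 0) y := by
        rw [max_eq_right h.le, mul_zero]; exact hasDerivAt_const _ _
      refine this.congr_of_eventuallyEq ?_
      filter_upwards [gt_mem_nhds h] with s hs
      simp [max_eq_right hs.le]
    · have : HasDerivAt (fun s : ℝ => s ^ 2) (2 * max y 0) y := by
        rw [max_eq_left h.le]; simpa using hasDerivAt_pow 2 y
      refine this.congr_of_eventuallyEq ?_
      filter_upwards [lt_mem_nhds h] with s hs
      simp [max_eq_left (le_of_lt hs)]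
  rcases eq_or_ne t 0 with rfl | ht
  · exact hasDerivAt_of_hasDerivAt_of_ne (g := fun y => 2 * max y 0) hne
      (by fun_prop) (by fun_prop)
  · exact hne t ht

/-- The smooth approximation `√((t - k)₊² + ε²) - ε` of the positive part `(t - k)₊`. -/
noncomputable def smoothPos (k ε t : ℝ) : ℝ := √(max (t - k) 0 ^ 2 + ε ^ 2) - ε

/-- The derivative of `smoothPos`. -/
noncomputable def smoothPosDeriv (k ε t : ℝ) : ℝ := max (t - k) 0 / √(max (t - k) 0 ^ 2 + ε ^ 2)

lemma hasDerivAt_smoothPos (k : ℝ) {ε : ℝ} (hε : 0 < ε) (t : ℝ) :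
    HasDerivAt (smoothPos k ε) (smoothPosDeriv k ε t) t := by
  have h1 : HasDerivAt (fun t => max (t - k) 0 ^ 2 + ε ^ 2) (2 * max (t - k) 0) t := by
    have := (hasDerivAt_max_zero_sq (t - k)).comp_sub_const t k
    simpa using this.add_const (ε ^ 2)
  have h2 := (h1.sqrt (by positivity)).sub_const ε
  have e : smoothPosDeriv k ε t = 2 * max (t - k) 0 / (2 * √(max (t - k) 0 ^ 2 + ε ^ 2)) :=
    (mul_div_mul_left _ _ two_ne_zero).symm
  rw [e]
  exact h2

lemma continuous_smoothPosDeriv (k : ℝ) {ε : ℝ} (hε : 0 < ε) : Continuous (smoothPosDeriv k ε) := by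
  refine Continuous.div (by fun_prop) (by fun_prop) fun t => ?_
  positivity

lemma abs_smoothPosDeriv_le (k : ℝ) {ε : ℝ} (hε : 0 < ε) (t : ℝ) : |smoothPosDeriv k ε t| ≤ 1 := by
  rw [smoothPosDeriv, abs_of_nonneg (by positivity)]
  refine div_le_one_of_le₀ (Real.le_sqrt_of_sq_le ?_) (Real.sqrt_nonneg _)
  linarith [sq_nonneg ε]

/-- $\sqrt{a^2 + \varepsilon^2} \le a + \varepsilon$ for $a \ge 0$, and $(t-k)_+ \le |t|$ because $k
\ge 0$. This is the majorant, uniform in $\varepsilon$, for removing the regularization. -/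
lemma abs_smoothPos_le {k : ℝ} (hk : 0 ≤ k) {ε : ℝ} (hε : 0 < ε) (t : ℝ) :
    |smoothPos k ε t| ≤ |t| := by
  have h0 : ε ≤ √(max (t - k) 0 ^ 2 + ε ^ 2) :=
    Real.le_sqrt_of_sq_le (by linarith [sq_nonneg (max (t - k) 0)])
  have h1 : √(max (t - k) 0 ^ 2 + ε ^ 2) ≤ max (t - k) 0 + ε := by
    refine Real.sqrt_le_iff.2 ⟨by positivity, ?_⟩
    nlinarith [le_max_right (t - k) 0]
  rw [smoothPos, abs_of_nonneg (by linarith)]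
  have h2 : max (t - k) 0 ≤ |t| := max_le (by linarith [le_abs_self t]) (abs_nonneg t)
  linarith

lemma tendsto_smoothPos (k t : ℝ) :
    Tendsto (fun n : ℕ => smoothPos k (1 / ((n : ℝ) + 1)) t) atTop (𝓝 (max (t - k) 0)) := by
  have h0 := tendsto_one_div_add_atTop_nhds_zero_nat (𝕜 := ℝ)
  have h1 := (((h0.pow 2).const_add (max (t - k) 0 ^ 2)).sqrt).sub h0
  simpa [smoothPos, Real.sqrt_sq (le_max_right (t - k) 0)] using h1

/-- For $t \le k$ the value is `0` for every $\varepsilon$, so the limit selects the strict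
superlevel set, and the gradient of the truncation vanishes off it. -/
lemma tendsto_smoothPosDeriv (k t : ℝ) :
    Tendsto (fun n : ℕ => smoothPosDeriv k (1 / ((n : ℝ) + 1)) t) atTop
      (𝓝 (if k < t then 1 else 0)) := by
  split_ifs with h
  · have h0 := tendsto_one_div_add_atTop_nhds_zero_nat (𝕜 := ℝ)
    have hp : 0 < max (t - k) 0 := lt_max_of_lt_left (sub_pos.2 h)
    have h1 := ((h0.pow 2).const_add (max (t - k) 0 ^ 2)).sqrt
    have h2 : Tendsto (fun n : ℕ => smoothPosDeriv k (1 / ((n : ℝ) + 1)) t) atTop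
        (𝓝 (max (t - k) 0 / √(max (t - k) 0 ^ 2 + 0 ^ 2))) :=
      tendsto_const_nhds.div h1 (by
        simp only [ne_eq, OfNat.ofNat_ne_zero, not_false_eq_true, zero_pow, add_zero,
          Real.sqrt_sq hp.le]
        exact hp.ne')
    simpa [Real.sqrt_sq hp.le, div_self hp.ne'] using h2
  · have : max (t - k) 0 = 0 := max_eq_right (by linarith)
    simp [smoothPosDeriv, this]

/-- Truncations `(Re u - k)₊` of Sobolev functions are Sobolev functions. -/
theorem SobolevW1.exists_truncation {d : ℕ} {Ω : Set (EuclideanSpace ℝ (Fin d))} (hΩ : IsOpen Ω)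
    (u : SobolevW1 Ω 2) {k : ℝ} (hk : 0 ≤ k) :
    ∃ v : SobolevW1 Ω 2,
      (∀ᵐ x ∂volume.restrict Ω, v.fn x = ((max ((u.fn x).re - k) 0 : ℝ) : ℂ)) ∧
      ∀ j, ∀ᵐ x ∂volume.restrict Ω,
        v.grad j x = if k < (u.fn x).re then ((u.grad j x).re : ℂ) else 0 := by
  have hum := Complex.continuous_re.comp_aestronglyMeasurable (Lp.memLp u.fn).1
  have h1 : MemLp (fun x => ((max ((u.fn x).re - k) 0 : ℝ) : ℂ)) 2 (volume.restrict Ω) := by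
    refine (Lp.memLp u.fn).of_le ?_ (Eventually.of_forall fun x => ?_)
    · exact (show Continuous fun t : ℝ => ((max (t - k) 0 : ℝ) : ℂ) by fun_prop)
        |>.comp_aestronglyMeasurable hum
    · rw [Complex.norm_real, Real.norm_of_nonneg (le_max_right _ _)]
      exact max_le (by linarith [Complex.re_le_norm (u.fn x)]) (norm_nonneg _)
  have h2 : ∀ j, MemLp (fun x => (((if k < (u.fn x).re then 1 else 0) * (u.grad j x).re : ℝ) : ℂ)) 2
      (volume.restrict Ω) := by
    intro j
    refine (Lp.memLp (u.grad j)).of_le ?_ (Eventually.of_forall fun x => ?_)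
    · refine Complex.continuous_ofReal.comp_aestronglyMeasurable (AEStronglyMeasurable.mul ?_
        (Complex.continuous_re.comp_aestronglyMeasurable (Lp.memLp (u.grad j)).1))
      have : Measurable fun t : ℝ => if k < t then (1 : ℝ) else 0 :=
        Measurable.ite measurableSet_Ioi measurable_const measurable_const
      exact (this.comp_aemeasurable hum.aemeasurable).aestronglyMeasurable
    · rw [Complex.norm_real, norm_mul]
      refine (mul_le_of_le_one_left (norm_nonneg _) ?_).trans (Complex.abs_re_le_norm _)
      split_ifs <;> simp
  have h3 := fun j => hasWeakPartialDeriv_comp_re_of_tendsto hΩ (Lp.memLp u.fn)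
    (fun j => Lp.memLp (u.grad j)) u.hasWeakPartialDeriv
    (F := fun n : ℕ => smoothPos k (1 / ((n : ℝ) + 1)))
    (fun n t => hasDerivAt_smoothPos k (by positivity) t)
    (fun n => continuous_smoothPosDeriv k (by positivity))
    (fun n t => abs_smoothPos_le hk (by positivity) t)
    (fun n t => abs_smoothPosDeriv_le k (by positivity) t)
    (tendsto_smoothPos k) (tendsto_smoothPosDeriv k) j
  refine ⟨SobolevW1.mk _ _ h1 h2 h3, h1.coeFn_toLp, fun j => ?_⟩
  filter_upwards [(h2 j).coeFn_toLp] with x hx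
  refine hx.trans ?_
  split_ifs <;> simp

end Truncation

/-! ### Poincaré's inequality on balls -/

section Poincare

lemma lintegral_comp_add_smul {E : Type*} [NormedAddCommGroup E] [NormedSpace ℝ E]
    [FiniteDimensional ℝ E] [MeasurableSpace E] [BorelSpace E] (m : Measure E)
    [m.IsAddHaarMeasure] {f : E → ℝ≥0∞} (hf : Measurable f) (a : E) {t : ℝ} (ht : t ≠ 0) :
    ∫⁻ x, f (a + t • x) ∂m = ENNReal.ofReal |(t ^ Module.finrank ℝ E)⁻¹| * ∫⁻ x, f x ∂m := by
  have h1 : ∫⁻ x, f (a + t • x) ∂m = ∫⁻ x, f (a + x) ∂(Measure.map (fun x => t • x) m) := by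
    rw [lintegral_map (by fun_prop) (by fun_prop)]
  rw [h1, Measure.map_addHaar_smul m ht, lintegral_smul_measure, lintegral_add_left_eq_self,
    smul_eq_mul]

variable {d : ℕ}

lemma norm_sq_apply_le (L : EuclideanSpace ℝ (Fin d) →L[ℝ] ℂ) (v : EuclideanSpace ℝ (Fin d)) :
    ‖L v‖ ^ 2 ≤ ‖v‖ ^ 2 * ∑ j, ‖L (EuclideanSpace.single j 1)‖ ^ 2 := by
  have hv : v = ∑ j, v j • EuclideanSpace.single j (1 : ℝ) := by
    ext i
    simp [Finset.sum_apply, Pi.single_apply]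
  have h1 : ‖L v‖ ≤ ∑ j, |v j| * ‖L (EuclideanSpace.single j 1)‖ := by
    conv_lhs => rw [hv, map_sum]
    refine (norm_sum_le _ _).trans (le_of_eq (Finset.sum_congr rfl fun j _ => ?_))
    rw [map_smul, norm_smul, Real.norm_eq_abs]
  calc ‖L v‖ ^ 2 ≤ (∑ j, |v j| * ‖L (EuclideanSpace.single j 1)‖) ^ 2 := by gcongr
    _ ≤ (∑ j, |v j| ^ 2) * ∑ j, ‖L (EuclideanSpace.single j 1)‖ ^ 2 :=
      Finset.sum_mul_sq_le_sq_mul_sq _ _ _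
    _ = _ := by rw [EuclideanSpace.norm_sq_eq]; simp

/-- The square of an increment of a smooth function is bounded by the energy along the segment. -/
lemma enorm_sub_sq_le {w : EuclideanSpace ℝ (Fin d) → ℂ} (hw : ContDiff ℝ ∞ w)
    (x y : EuclideanSpace ℝ (Fin d)) :
    ‖w x - w y‖ₑ ^ 2 ≤ ‖x - y‖ₑ ^ 2 * ∫⁻ t in Ioc (0 : ℝ) 1,
      ∑ j, ‖fderiv ℝ w ((1 - t) • y + t • x) (EuclideanSpace.single j 1)‖ₑ ^ 2 := by
  set γ : ℝ → EuclideanSpace ℝ (Fin d) := fun t => (1 - t) • y + t • x with hγ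
  have hγd : ∀ t, HasDerivAt γ (x - y) t := fun t => by
    have := (((hasDerivAt_id t).const_sub 1).smul_const y).add ((hasDerivAt_id t).smul_const x)
    refine this.congr_deriv ?_
    simp [sub_eq_neg_add]
  have hγc : Continuous γ := by fun_prop
  have hd : ∀ t, HasDerivAt (fun t => w (γ t)) (fderiv ℝ w (γ t) (x - y)) t := fun t =>
    ((hw.differentiable (by simp) (γ t)).hasFDerivAt).comp_hasDerivAt t (hγd t)
  have hc : Continuous fun t => fderiv ℝ w (γ t) (x - y) :=
    ((hw.continuous_fderiv (by simp)).comp hγc).clm_apply continuous_const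
  have hint : w x - w y = ∫ t in Ioc (0 : ℝ) 1, fderiv ℝ w (γ t) (x - y) := by
    rw [← intervalIntegral.integral_of_le zero_le_one,
      intervalIntegral.integral_eq_sub_of_hasDerivAt (fun t _ => hd t) (hc.intervalIntegrable _ _)]
    simp [hγ]
  have hJ := lintegral_mul_sq_le (m := volume.restrict (Ioc (0 : ℝ) 1)) (ρ := fun _ => 1)
    (f := fun t => ‖fderiv ℝ w (γ t) (x - y)‖ₑ) aemeasurable_const (by simp)
    hc.enorm.aemeasurable
  simp only [one_mul] at hJ
  calc ‖w x - w y‖ₑ ^ 2 ≤ (∫⁻ t in Ioc (0 : ℝ) 1, ‖fderiv ℝ w (γ t) (x - y)‖ₑ) ^ 2 := by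
        rw [hint]
        gcongr
        exact enorm_integral_le_lintegral_enorm _
    _ ≤ ∫⁻ t in Ioc (0 : ℝ) 1, ‖fderiv ℝ w (γ t) (x - y)‖ₑ ^ 2 := hJ
    _ ≤ ∫⁻ t in Ioc (0 : ℝ) 1, ‖x - y‖ₑ ^ 2 *
        ∑ j, ‖fderiv ℝ w (γ t) (EuclideanSpace.single j 1)‖ₑ ^ 2 := by
      refine lintegral_mono fun t => ?_
      have := norm_sq_apply_le (fderiv ℝ w (γ t)) (x - y)
      simp only [← ofReal_norm, ← ENNReal.ofReal_pow (norm_nonneg _)]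
      rw [← ENNReal.ofReal_sum_of_nonneg fun _ _ => by positivity,
        ← ENNReal.ofReal_mul (by positivity)]
      exact ENNReal.ofReal_le_ofReal this
    _ = _ := lintegral_const_mul' _ _ (by simp)

/-- One of $t$, $1-t$ is at least $\frac12$; substituting in the corresponding variable keeps the
Jacobian at most $2^d$, and the other variable contributes the volume of `B`. This avoids the
blow-up of either substitution near an endpoint. -/
lemma lintegral_segment_le (B : Set (EuclideanSpace ℝ (Fin d)))
    {H : EuclideanSpace ℝ (Fin d) → ℝ≥0∞} (hH : Measurable H) (t : ℝ) :
    ∫⁻ x in B, ∫⁻ y in B, H ((1 - t) • y + t • x) ≤ 2 ^ d * volume B * ∫⁻ x, H x := by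
  have key : ∀ s : ℝ, 1 / 2 ≤ s → ∀ y, ∫⁻ x in B, H (y + s • x) ≤ 2 ^ d * ∫⁻ x, H x := by
    intro s hs y
    have hs0 : 0 < s := by linarith
    refine (setLIntegral_le_lintegral _ _).trans ?_
    rw [lintegral_comp_add_smul volume hH y hs0.ne']
    gcongr
    rw [finrank_euclideanSpace, Fintype.card_fin, abs_of_nonneg (by positivity), ← inv_pow,
      ENNReal.ofReal_pow (by positivity)]
    gcongr
    rw [show (2 : ℝ≥0∞) = ENNReal.ofReal 2 by simp]
    refine ENNReal.ofReal_le_ofReal ?_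
    rw [inv_le_comm₀ hs0 two_pos]
    linarith
  rcases le_total (1 / 2) t with h | h
  · rw [lintegral_lintegral_swap (by fun_prop)]
    calc _ ≤ ∫⁻ _ in B, 2 ^ d * ∫⁻ x, H x := lintegral_mono fun y => key t h _
      _ = _ := by rw [setLIntegral_const]; ring
  · calc _ ≤ ∫⁻ _ in B, 2 ^ d * ∫⁻ x, H x := lintegral_mono fun x => by
          simp only [add_comm _ (t • x)]
          exact key (1 - t) (by linarith) _
      _ = _ := by rw [setLIntegral_const]; ring

/-- Poincaré's inequality in double integral form for smooth functions on balls. -/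
lemma lintegral_lintegral_sub_sq_le {w : EuclideanSpace ℝ (Fin d) → ℂ} (hw : ContDiff ℝ ∞ w)
    (a : EuclideanSpace ℝ (Fin d)) {R : ℝ} :
    ∫⁻ x in Metric.closedBall a R, ∫⁻ y in Metric.closedBall a R, ‖w x - w y‖ₑ ^ 2
      ≤ ENNReal.ofReal (2 * R) ^ 2 * (2 ^ d * volume (Metric.closedBall a R)) *
        ∑ j, ∫⁻ x in Metric.closedBall a R, ‖fderiv ℝ w x (EuclideanSpace.single j 1)‖ₑ ^ 2 := by
  set B := Metric.closedBall a R
  have hBm : MeasurableSet B := measurableSet_closedBall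
  have hdj : ∀ j : Fin d, Measurable fun x => ‖fderiv ℝ w x (EuclideanSpace.single j 1)‖ₑ ^ 2 :=
    fun j => ((hw.continuous_fderiv (by simp)).clm_apply continuous_const).measurable.enorm.pow_const 2
  set H₀ : EuclideanSpace ℝ (Fin d) → ℝ≥0∞ := fun x =>
    ∑ j, ‖fderiv ℝ w x (EuclideanSpace.single j 1)‖ₑ ^ 2 with hH₀
  have hH₀m : Measurable H₀ := Finset.measurable_fun_sum _ fun j _ => hdj j
  -- Cutting off to the ball allows the substitution to run over the whole space; by convexity the
  -- segments never leave `B`, so nothing is lost.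
  set H := B.indicator H₀ with hHdef
  have hH : Measurable H := hH₀m.indicator hBm
  have hHint : ∫⁻ x, H x = ∑ j, ∫⁻ x in B, ‖fderiv ℝ w x (EuclideanSpace.single j 1)‖ₑ ^ 2 := by
    rw [lintegral_indicator hBm, lintegral_finsetSum _ fun j _ => hdj j]
  have hpt : ∀ x ∈ B, ∀ y ∈ B, ‖w x - w y‖ₑ ^ 2
      ≤ ENNReal.ofReal (2 * R) ^ 2 * ∫⁻ t in Ioc (0 : ℝ) 1, H ((1 - t) • y + t • x) := by
    intro x hx y hy
    refine (enorm_sub_sq_le hw x y).trans (mul_le_mul' ?_ (le_of_eq ?_))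
    · gcongr
      rw [← ofReal_norm, ← dist_eq_norm]
      refine ENNReal.ofReal_le_ofReal ?_
      have h1 := Metric.mem_closedBall.1 hx
      have h2 := Metric.mem_closedBall'.1 hy
      linarith [dist_triangle x a y]
    · refine setLIntegral_congr_fun measurableSet_Ioc fun t ht => ?_
      rw [hHdef, indicator_of_mem]
      exact (convex_closedBall a R) hy hx (by linarith [ht.2]) ht.1.le (by ring)
  have hRt : ENNReal.ofReal (2 * R) ^ 2 ≠ ⊤ := ENNReal.pow_ne_top ENNReal.ofReal_ne_top
  calc _ ≤ ∫⁻ x in B, ∫⁻ y in B, ENNReal.ofReal (2 * R) ^ 2 *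
        ∫⁻ t in Ioc (0 : ℝ) 1, H ((1 - t) • y + t • x) :=
      setLIntegral_mono' hBm fun x hx => setLIntegral_mono' hBm fun y hy => hpt x hx y hy
    _ = ENNReal.ofReal (2 * R) ^ 2 * ∫⁻ x in B, ∫⁻ y in B,
        ∫⁻ t in Ioc (0 : ℝ) 1, H ((1 - t) • y + t • x) := by
      rw [← lintegral_const_mul' _ _ hRt]
      refine lintegral_congr fun x => ?_
      rw [lintegral_const_mul' _ _ hRt]
    _ = ENNReal.ofReal (2 * R) ^ 2 * ∫⁻ x in B, ∫⁻ t in Ioc (0 : ℝ) 1, ∫⁻ y in B,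
        H ((1 - t) • y + t • x) := by
      congr 1
      refine lintegral_congr fun x => lintegral_lintegral_swap ?_
      exact (hH.comp (f := fun z : EuclideanSpace ℝ (Fin d) × ℝ => (1 - z.2) • z.1 + z.2 • x)
        (by fun_prop)).aemeasurable
    _ = ENNReal.ofReal (2 * R) ^ 2 * ∫⁻ t in Ioc (0 : ℝ) 1, ∫⁻ x in B, ∫⁻ y in B,
        H ((1 - t) • y + t • x) := by
      congr 1
      refine lintegral_lintegral_swap (Measurable.aemeasurable ?_)
      exact Measurable.lintegral_prod_right'
        (f := fun z : (EuclideanSpace ℝ (Fin d) × ℝ) × EuclideanSpace ℝ (Fin d) =>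
          H ((1 - z.1.2) • z.2 + z.1.2 • z.1.1)) (hH.comp (by fun_prop))
    _ ≤ ENNReal.ofReal (2 * R) ^ 2 * ∫⁻ t in Ioc (0 : ℝ) 1,
        2 ^ d * volume B * ∫⁻ x, H x := by
      exact mul_le_mul' le_rfl (lintegral_mono fun t => lintegral_segment_le B hH t)
    _ = _ := by
      rw [setLIntegral_const, hHint]
      simp [mul_assoc]

/-- Poincaré's inequality for Sobolev functions on balls in the domain. -/
theorem SobolevW1.exists_lintegral_sub_const_sq_le {Ω : Set (EuclideanSpace ℝ (Fin d))}
    (hΩ : IsOpen Ω) {a : EuclideanSpace ℝ (Fin d)} {R : ℝ} (hR : 0 < R)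
    (hB : Metric.closedBall a R ⊆ Ω) :
    ∃ C : ℝ≥0∞, C ≠ ⊤ ∧ ∀ u : SobolevW1 Ω 2, ∃ c : ℂ,
      ∫⁻ x in Metric.closedBall a R, ‖u.fn x - c‖ₑ ^ 2
        ≤ C * ∑ j, ∫⁻ x in Ω, ‖u.grad j x‖ₑ ^ 2 := by
  set B := Metric.closedBall a R with hBdef
  have hv0 : volume B ≠ 0 := (Metric.measure_closedBall_pos volume a hR).ne'
  have hvt : volume B ≠ ⊤ := measure_closedBall_lt_top.ne
  set C₀ := ENNReal.ofReal (2 * R) ^ 2 * (2 ^ d * volume B) with hC₀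
  have hC₀t : C₀ ≠ ⊤ := by
    exact ENNReal.mul_ne_top (ENNReal.pow_ne_top ENNReal.ofReal_ne_top)
      (ENNReal.mul_ne_top (by simp) hvt)
  refine ⟨(volume B)⁻¹ * C₀, ENNReal.mul_ne_top (ENNReal.inv_ne_top.2 hv0) hC₀t, fun u => ?_⟩
  obtain ⟨w, hws, hwae, -, hwj⟩ := exists_smooth_approx hΩ (Lp.memLp u.fn)
    (fun j => Lp.memLp (u.grad j)) u.hasWeakPartialDeriv (isCompact_closedBall a R) hB
  have hwaeB : ∀ᵐ x ∂volume.restrict B, Tendsto (fun n => w n x) atTop (𝓝 (u.fn x)) :=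
    ae_mono (Measure.restrict_mono hB le_rfl) hwae
  have hum : Measurable u.fn := (Lp.stronglyMeasurable u.fn).measurable
  have hwm : ∀ n, Measurable (w n) := fun n => (hws n).continuous.measurable
  set D := ∑ j, ∫⁻ x in Ω, ‖u.grad j x‖ₑ ^ 2
  -- Fatou in both variables; the energies of the approximants on `B` are bounded by the energy of
  -- `u` on $\Omega$.
  have hdouble : ∫⁻ x in B, ∫⁻ y in B, ‖u.fn x - u.fn y‖ₑ ^ 2 ≤ C₀ * D := by
    have h1 : ∀ x, Tendsto (fun n => w n x) atTop (𝓝 (u.fn x)) →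
        ∫⁻ y in B, ‖u.fn x - u.fn y‖ₑ ^ 2
          ≤ liminf (fun n => ∫⁻ y in B, ‖w n x - w n y‖ₑ ^ 2) atTop := by
      intro x hx
      refine le_trans (lintegral_mono_ae ?_) (lintegral_liminf_le fun n => by fun_prop)
      filter_upwards [hwaeB] with y hy
      exact ((ENNReal.continuous_pow 2).tendsto _ |>.comp (hx.sub hy).enorm).liminf_eq.ge
    have h2 : ∀ n, Measurable fun x => ∫⁻ y in B, ‖w n x - w n y‖ₑ ^ 2 := fun n =>
      Measurable.lintegral_prod_right' (f := fun z : _ × _ => ‖w n z.1 - w n z.2‖ₑ ^ 2)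
        (by fun_prop)
    calc _ ≤ ∫⁻ x in B, liminf (fun n => ∫⁻ y in B, ‖w n x - w n y‖ₑ ^ 2) atTop := by
          refine lintegral_mono_ae ?_
          filter_upwards [hwaeB] with x hx using h1 x hx
      _ ≤ liminf (fun n => ∫⁻ x in B, ∫⁻ y in B, ‖w n x - w n y‖ₑ ^ 2) atTop :=
        lintegral_liminf_le h2
      _ ≤ C₀ * D := by
        refine liminf_le_of_le (by isBoundedDefault) fun b hb => ?_
        obtain ⟨n, hn⟩ := hb.exists
        refine hn.trans ((lintegral_lintegral_sub_sq_le (hws n) a).trans ?_)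
        exact mul_le_mul' le_rfl (Finset.sum_le_sum fun j _ => (hwj j).1 n)
  have hm : Measurable fun x => ∫⁻ y in B, ‖u.fn x - u.fn y‖ₑ ^ 2 :=
    Measurable.lintegral_prod_right' (f := fun z : _ × _ => ‖u.fn z.1 - u.fn z.2‖ₑ ^ 2)
      (by fun_prop)
  -- The constant is the value of `u` at a point where the inner integral does not exceed its
  -- average; no mean value is needed.
  obtain ⟨x, -, hx⟩ := exists_le_setLAverage hv0 hvt hm.aemeasurable
  refine ⟨u.fn x, ?_⟩
  calc _ = ∫⁻ y in B, ‖u.fn x - u.fn y‖ₑ ^ 2 := by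
        refine lintegral_congr fun y => ?_
        rw [enorm_sub_rev]
    _ ≤ _ := hx
    _ ≤ (volume B)⁻¹ * (C₀ * D) := by
      rw [setLAverage_eq, ENNReal.div_eq_inv_mul]
      exact mul_le_mul' le_rfl hdouble
    _ = _ := (mul_assoc _ _ _).symm

end Poincare

/-! ### Completeness of $W^{1,2}$ and boundedness of the embedding -/

namespace SobolevW1

section Basic

variable {d : ℕ} {Ω : Set (EuclideanSpace ℝ (Fin d))} {p : ℝ≥0∞} [Fact (1 ≤ p)]

/-- The underlying function as a continuous linear map. -/
noncomputable def fnL (Ω : Set (EuclideanSpace ℝ (Fin d))) (p : ℝ≥0∞) [Fact (1 ≤ p)] :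
    SobolevW1 Ω p →L[ℂ] Lp ℂ p (volume.restrict Ω) :=
  (WithLp.fstL p ℂ _ _).comp (sobolevW1Submodule Ω p).subtypeL

/-- The weak partial derivatives as continuous linear maps. -/
noncomputable def gradL (Ω : Set (EuclideanSpace ℝ (Fin d))) (p : ℝ≥0∞) [Fact (1 ≤ p)] (j : Fin d) :
    SobolevW1 Ω p →L[ℂ] Lp ℂ p (volume.restrict Ω) :=
  ((PiLp.proj (𝕜 := ℂ) p _ j).comp (WithLp.sndL p ℂ _ _)).comp (sobolevW1Submodule Ω p).subtypeL

lemma fn_add (u v : SobolevW1 Ω p) : (u + v).fn = u.fn + v.fn := rfl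

lemma fn_sub (u v : SobolevW1 Ω p) : (u - v).fn = u.fn - v.fn := rfl

lemma fn_smul (c : ℂ) (u : SobolevW1 Ω p) : (c • u).fn = c • u.fn := rfl

lemma grad_sub (u v : SobolevW1 Ω p) (j : Fin d) : (u - v).grad j = u.grad j - v.grad j := rfl

lemma grad_smul (c : ℂ) (u : SobolevW1 Ω p) (j : Fin d) : (c • u).grad j = c • u.grad j := rfl

lemma mk_fn_ae {u : EuclideanSpace ℝ (Fin d) → ℂ} {g : Fin d → EuclideanSpace ℝ (Fin d) → ℂ}
    (hu : MemLp u p (volume.restrict Ω)) (hg : ∀ j, MemLp (g j) p (volume.restrict Ω))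
    (h : ∀ j, HasWeakPartialDeriv Ω j u (g j)) :
    (mk u g hu hg h).fn =ᵐ[volume.restrict Ω] u := hu.coeFn_toLp

lemma mk_grad_ae {u : EuclideanSpace ℝ (Fin d) → ℂ} {g : Fin d → EuclideanSpace ℝ (Fin d) → ℂ}
    (hu : MemLp u p (volume.restrict Ω)) (hg : ∀ j, MemLp (g j) p (volume.restrict Ω))
    (h : ∀ j, HasWeakPartialDeriv Ω j u (g j)) (j : Fin d) :
    (mk u g hu hg h).grad j =ᵐ[volume.restrict Ω] g j := (hg j).coeFn_toLp

lemma one_fn_ae (hfin : volume Ω ≠ ⊤) :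
    (one hfin : SobolevW1 Ω p).fn =ᵐ[volume.restrict Ω] fun _ => 1 := mk_fn_ae ..

lemma one_grad (hfin : volume Ω ≠ ⊤) (j : Fin d) : (one hfin : SobolevW1 Ω p).grad j = 0 := by
  have h : (one hfin : SobolevW1 Ω p).grad j =ᵐ[volume.restrict Ω] fun _ => 0 := mk_grad_ae ..
  exact Lp.ext (h.trans (Lp.coeFn_zero ..).symm)

lemma norm_sq (u : SobolevW1 Ω 2) : ‖u‖ ^ 2 = ‖u.fn‖ ^ 2 + ∑ j, ‖u.grad j‖ ^ 2 := by
  have h1 : ‖u‖ = ‖u.1‖ := rfl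
  rw [h1, WithLp.prod_norm_sq_eq_of_L2, PiLp.norm_sq_eq_of_L2]
  rfl

lemma norm_fn_le (u : SobolevW1 Ω 2) : ‖u.fn‖ ≤ ‖u‖ := by
  refine le_of_sq_le_sq ?_ (norm_nonneg _)
  rw [norm_sq]
  exact le_add_of_nonneg_right (by positivity)

lemma norm_grad_le (u : SobolevW1 Ω 2) (j : Fin d) : ‖u.grad j‖ ≤ ‖u‖ := by
  refine le_of_sq_le_sq ?_ (norm_nonneg _)
  rw [norm_sq]
  refine le_trans ?_ (le_add_of_nonneg_left (by positivity))
  exact Finset.single_le_sum (f := fun j => ‖u.grad j‖ ^ 2) (fun _ _ => by positivity)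
    (Finset.mem_univ j)

/-- Triangle inequality over the $d+1$ components. This crude bound avoids computing with the
exponent $p$ and is the origin of the factor $d+1$ in `norm_incl_le`. -/
lemma norm_le_sum (u : SobolevW1 Ω p) : ‖u‖ ≤ ‖u.fn‖ + ∑ j, ‖u.grad j‖ := by
  have h1 : ‖u‖ = ‖u.1‖ := rfl
  have h2 : u.1 = WithLp.toLp p (u.1.fst, 0) + WithLp.toLp p (0, u.1.snd) := by
    apply (WithLp.equiv p _).injective
    ext1
    · exact (add_zero _).symm
    · exact (zero_add _).symm
  have h3 : u.1.snd = ∑ j, PiLp.single p j (u.1.snd j) := by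
    apply (WithLp.equiv p _).injective
    ext1 j
    simp [Pi.single_apply]
  rw [h1, h2]
  refine (norm_add_le _ _).trans (add_le_add (WithLp.norm_toLp_fst ..).le ?_)
  rw [WithLp.norm_toLp_snd, h3]
  refine (norm_sum_le _ _).trans (le_of_eq (Finset.sum_congr rfl fun j _ => ?_))
  rw [PiLp.norm_single]
  rfl

/-- Integration against a fixed test function is an $L^2$ inner product, so each defining condition
is closed. Completeness is needed for the closed graph theorem and for Lax–Milgram. -/
lemma isClosed_sobolevW1Submodule :
    IsClosed (sobolevW1Submodule Ω 2 : Set (LpJet Ω 2)) := by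
  have hset : (sobolevW1Submodule Ω 2 : Set (LpJet Ω 2)) = ⋂ (j : Fin d)
      (φ : EuclideanSpace ℝ (Fin d) → ℝ) (_ : ContDiff ℝ ∞ φ) (_ : HasCompactSupport φ)
      (_ : tsupport φ ⊆ Ω), {w : LpJet Ω 2 |
        ∫ x in Ω, (fderiv ℝ φ x (EuclideanSpace.single j 1)) • w.fst x
          = - ∫ x in Ω, φ x • w.snd j x} := by
    ext w
    simp only [mem_iInter]
    rfl
  have hcont : ∀ ψ : EuclideanSpace ℝ (Fin d) → ℝ, Continuous ψ → HasCompactSupport ψ →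
      Continuous fun f : Lp ℂ 2 (volume.restrict Ω) => ∫ x in Ω, ψ x • f x := by
    intro ψ hψ hc
    have hm : MemLp (fun x => (ψ x : ℂ)) 2 (volume.restrict Ω) :=
      ((Complex.continuous_ofReal.comp hψ).memLp_of_hasCompactSupport
        (hc.comp_left (g := Complex.ofReal) Complex.ofReal_zero))
    have : (fun f : Lp ℂ 2 (volume.restrict Ω) => ∫ x in Ω, ψ x • f x)
        = fun f => inner ℂ (hm.toLp _) f := by
      ext f
      rw [L2.inner_def]
      refine integral_congr_ae ?_
      filter_upwards [hm.coeFn_toLp] with x hx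
      rw [hx]
      simp [mul_comm]
    rw [this]
    fun_prop
  rw [hset]
  refine isClosed_iInter fun j => isClosed_iInter fun φ => isClosed_iInter fun hφ =>
    isClosed_iInter fun hc => isClosed_iInter fun _ => ?_
  obtain ⟨hd, hdc⟩ := test_fderiv hφ hc (EuclideanSpace.single j 1)
  refine isClosed_eq ?_ ?_
  · exact (hcont _ hd hdc).comp (WithLp.fstL 2 ℂ _ _).continuous
  · exact ((hcont _ hφ.continuous hc).comp
      ((PiLp.proj (𝕜 := ℂ) 2 _ j).comp (WithLp.sndL 2 ℂ _ _)).continuous).neg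

instance instCompleteSpaceTwo : CompleteSpace (SobolevW1 Ω 2) :=
  isClosed_sobolevW1Submodule.completeSpace_coe

/-- A set-theoretic inclusion `W^{1,2}(Ω) ⊆ L^s(Ω)` is bounded. -/
theorem exists_eLpNorm_le {s : ℝ≥0∞} [Fact (1 ≤ s)]
    (hemb : ∀ u : SobolevW1 Ω 2, MemLp u.fn s (volume.restrict Ω)) :
    ∃ S : ℝ, 0 < S ∧ ∀ u : SobolevW1 Ω 2,
      eLpNorm u.fn s (volume.restrict Ω) ≤ ENNReal.ofReal (S * ‖u‖) := by
  let ι : SobolevW1 Ω 2 →ₗ[ℂ] Lp ℂ s (volume.restrict Ω) :=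
    { toFun := fun u => (hemb u).toLp _
      map_add' := fun u v => by
        rw [← MemLp.toLp_add, MemLp.toLp_eq_toLp_iff]
        exact Lp.coeFn_add u.fn v.fn
      map_smul' := fun c u => by
        rw [RingHom.id_apply, ← MemLp.toLp_const_smul, MemLp.toLp_eq_toLp_iff]
        exact Lp.coeFn_smul c u.fn }
  -- Closed graph: both modes of convergence imply convergence in measure, whose limits are a.e.
  -- unique.
  have hι : Continuous ι := by
    refine LinearMap.continuous_of_seq_closed_graph ι fun u x y hu hy => ?_
    have h1 := tendstoInMeasure_of_tendsto_Lp (((fnL Ω 2).continuous.tendsto x).comp hu)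
    have h2 := tendstoInMeasure_of_tendsto_Lp hy
    have h3 : TendstoInMeasure (volume.restrict Ω) (fun n => ((fnL Ω 2 ∘ u) n : _ → ℂ)) atTop y :=
      h2.congr_left fun n => (hemb (u n)).coeFn_toLp
    exact Lp.ext ((tendstoInMeasure_ae_unique h3 h1).trans (hemb x).coeFn_toLp.symm)
  let L : SobolevW1 Ω 2 →L[ℂ] Lp ℂ s (volume.restrict Ω) := ⟨ι, hι⟩
  refine ⟨‖L‖ + 1, by positivity, fun u => ?_⟩
  have h1 : eLpNorm u.fn s (volume.restrict Ω) = ENNReal.ofReal ‖L u‖ := by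
    rw [ofReal_norm]
    exact (Lp.enorm_toLp (hemb u)).symm
  rw [h1]
  refine ENNReal.ofReal_le_ofReal ((L.le_opNorm u).trans ?_)
  gcongr
  linarith

end Basic

end SobolevW1

/-! ### Poincaré's inequality on the domain -/

namespace SobolevW1

section GlobalPoincare

variable {d : ℕ} {Ω : Set (EuclideanSpace ℝ (Fin d))}

lemma _root_.lintegral_enorm_sq_eq {α : Type*} [MeasurableSpace α] {m : Measure α} (f : Lp ℂ 2 m) :
    ∫⁻ x, ‖f x‖ₑ ^ 2 ∂m = ENNReal.ofReal (‖f‖ ^ 2) := by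
  have h := eLpNorm_nnreal_pow_eq_lintegral (f := f) (μ := m) (p := 2) two_ne_zero
  rw [ENNReal.ofReal_pow (norm_nonneg _), ofReal_norm, Lp.enorm_def]
  simpa using h.symm

/-- The Dirichlet energy of `u`. -/
noncomputable def energy (u : SobolevW1 Ω 2) : ℝ := ∑ j, ‖u.grad j‖ ^ 2

lemma energy_nonneg (u : SobolevW1 Ω 2) : 0 ≤ energy u :=
  Finset.sum_nonneg fun _ _ => by positivity

lemma sum_lintegral_grad (u : SobolevW1 Ω 2) :
    ∑ j, ∫⁻ x in Ω, ‖u.grad j x‖ₑ ^ 2 = ENNReal.ofReal (energy u) := by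
  rw [energy, ENNReal.ofReal_sum_of_nonneg fun _ _ => by positivity]
  exact Finset.sum_congr rfl fun j _ => lintegral_enorm_sq_eq _

/-- On `S`, the deviation from the constant `c u` is controlled by the energy of `u`. -/
def PoincareOn (c : SobolevW1 Ω 2 → ℂ) (S : Set (EuclideanSpace ℝ (Fin d))) : Prop :=
  ∃ C : ℝ≥0∞, C ≠ ⊤ ∧ ∀ u : SobolevW1 Ω 2,
    ∫⁻ x in S, ‖u.fn x - c u‖ₑ ^ 2 ≤ C * ENNReal.ofReal (energy u)

lemma PoincareOn.mono {c : SobolevW1 Ω 2 → ℂ} {S S' : Set (EuclideanSpace ℝ (Fin d))}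
    (h : PoincareOn c S) (hS : S' ⊆ S) : PoincareOn c S' := by
  obtain ⟨C, hC, h⟩ := h
  exact ⟨C, hC, fun u => (lintegral_mono_set hS).trans (h u)⟩

lemma PoincareOn.union {c : SobolevW1 Ω 2 → ℂ} {S S' : Set (EuclideanSpace ℝ (Fin d))}
    (h : PoincareOn c S) (h' : PoincareOn c S') : PoincareOn c (S ∪ S') := by
  obtain ⟨C, hC, h⟩ := h
  obtain ⟨C', hC', h'⟩ := h'
  refine ⟨C + C', ENNReal.add_ne_top.2 ⟨hC, hC'⟩, fun u => (lintegral_union_le _ _ _).trans ?_⟩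
  rw [add_mul]
  exact add_le_add (h u) (h' u)

lemma enorm_sub_sq_le_two_mul (a b z : ℂ) :
    ‖a - b‖ₑ ^ 2 ≤ 2 * (‖z - a‖ₑ ^ 2 + ‖z - b‖ₑ ^ 2) := by
  simp only [← ofReal_norm, ← ENNReal.ofReal_pow (norm_nonneg _)]
  rw [← ENNReal.ofReal_add (by positivity) (by positivity),
    show (2 : ℝ≥0∞) = ENNReal.ofReal 2 by simp, ← ENNReal.ofReal_mul zero_le_two]
  refine ENNReal.ofReal_le_ofReal ?_
  have h1 : ‖a - b‖ ≤ ‖z - a‖ + ‖z - b‖ := by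
    rw [norm_sub_rev z a]
    exact norm_sub_le_norm_sub_add_norm_sub a z b
  nlinarith [sq_nonneg (‖z - a‖ - ‖z - b‖), norm_nonneg (a - b)]

/-- Two sets with a common part of positive measure share their constants. -/
lemma PoincareOn.trans {c c' : SobolevW1 Ω 2 → ℂ} {S S' : Set (EuclideanSpace ℝ (Fin d))}
    (h : PoincareOn c S) (h' : PoincareOn c' S') (hpos : volume (S ∩ S') ≠ 0)
    (hfin : volume S' ≠ ⊤) : PoincareOn c S' := by
  obtain ⟨C, hC, h⟩ := h
  obtain ⟨C', hC', h'⟩ := h'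
  have hI : volume (S ∩ S') ≠ ⊤ := measure_ne_top_of_subset inter_subset_right hfin
  have hum : ∀ u : SobolevW1 Ω 2, Measurable u.fn := fun u => (Lp.stronglyMeasurable u.fn).measurable
  -- On the overlap both deviations are controlled and $|c - c'|^2$ does not depend on $x$:
  -- integrate and divide by the measure of the overlap.
  have hc : ∀ u : SobolevW1 Ω 2, ‖c u - c' u‖ₑ ^ 2
      ≤ (volume (S ∩ S'))⁻¹ * (2 * ((C + C') * ENNReal.ofReal (energy u))) := by
    intro u
    rw [mul_comm, ← div_eq_mul_inv, ENNReal.le_div_iff_mul_le (Or.inl hpos) (Or.inl hI)]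
    have := hum u
    calc ‖c u - c' u‖ₑ ^ 2 * volume (S ∩ S') = ∫⁻ _ in S ∩ S', ‖c u - c' u‖ₑ ^ 2 := by
          rw [setLIntegral_const]
      _ ≤ ∫⁻ x in S ∩ S', 2 * (‖u.fn x - c u‖ₑ ^ 2 + ‖u.fn x - c' u‖ₑ ^ 2) :=
        lintegral_mono fun x => enorm_sub_sq_le_two_mul _ _ _
      _ = 2 * ((∫⁻ x in S ∩ S', ‖u.fn x - c u‖ₑ ^ 2) + ∫⁻ x in S ∩ S', ‖u.fn x - c' u‖ₑ ^ 2) := by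
        rw [lintegral_const_mul' _ _ (by simp), lintegral_add_left (by fun_prop)]
      _ ≤ 2 * (C * ENNReal.ofReal (energy u) + C' * ENNReal.ofReal (energy u)) := by
        gcongr
        · exact (lintegral_mono_set inter_subset_left).trans (h u)
        · exact (lintegral_mono_set inter_subset_right).trans (h' u)
      _ = _ := by rw [add_mul]
  refine ⟨2 * (C' + (volume (S ∩ S'))⁻¹ * (2 * (C + C')) * volume S'), ?_, fun u => ?_⟩
  · have := ENNReal.inv_ne_top.2 hpos
    finiteness
  · have := hum u
    calc ∫⁻ x in S', ‖u.fn x - c u‖ₑ ^ 2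
        ≤ ∫⁻ x in S', 2 * (‖u.fn x - c' u‖ₑ ^ 2 + ‖c u - c' u‖ₑ ^ 2) := by
          refine lintegral_mono fun x => ?_
          have := enorm_sub_sq_le_two_mul (u.fn x) (c u) (c' u)
          rwa [enorm_sub_rev (c' u) (u.fn x), enorm_sub_rev (c' u) (c u)] at this
      _ = 2 * ((∫⁻ x in S', ‖u.fn x - c' u‖ₑ ^ 2) + ‖c u - c' u‖ₑ ^ 2 * volume S') := by
        rw [lintegral_const_mul' _ _ (by simp), lintegral_add_left (by fun_prop),
          setLIntegral_const]
      _ ≤ 2 * (C' * ENNReal.ofReal (energy u) + (volume (S ∩ S'))⁻¹ *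
          (2 * ((C + C') * ENNReal.ofReal (energy u))) * volume S') := by
        gcongr
        · exact h' u
        · exact hc u
      _ = _ := by ring

/-- In a connected open set Poincaré's inequality holds on compact sets with a common constant. -/
theorem exists_poincareOn (hΩ : IsOpen Ω) (hconn : IsConnected Ω) :
    ∃ c : SobolevW1 Ω 2 → ℂ, ∀ K ⊆ Ω, IsCompact K → PoincareOn c K := by
  have hloc : ∀ (a : EuclideanSpace ℝ (Fin d)) {R : ℝ}, 0 < R → Metric.closedBall a R ⊆ Ω →
      ∃ c, PoincareOn (Ω := Ω) c (Metric.closedBall a R) := by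
    intro a R hR hB
    obtain ⟨C, hC, h⟩ := exists_lintegral_sub_const_sq_le hΩ hR hB
    choose c hc using h
    exact ⟨c, C, hC, fun u => by rw [← sum_lintegral_grad]; exact hc u⟩
  obtain ⟨x₀, hx₀⟩ := hconn.nonempty
  obtain ⟨R₀, hR₀, hB₀⟩ := Metric.nhds_basis_closedBall.mem_iff.1 (hΩ.mem_nhds hx₀)
  obtain ⟨c, hc⟩ := hloc x₀ hR₀ hB₀
  -- The points near which the constant chosen at $x_0$ works. `G` is open, and relatively closed in
  -- $\Omega$ because a ball around a limit point overlaps a good ball in a set of positive measure.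
  set G : Set (EuclideanSpace ℝ (Fin d)) := {x | ∃ ρ > 0, PoincareOn c (Metric.closedBall x ρ)}
  have hGo : IsOpen G := by
    rw [Metric.isOpen_iff]
    rintro x ⟨ρ, hρ, hP⟩
    refine ⟨ρ, hρ, fun y hy => ⟨ρ - dist y x, sub_pos.2 hy, hP.mono ?_⟩⟩
    exact Metric.closedBall_subset_closedBall' (by linarith)
  have hsub : Ω ⊆ G := by
    refine hconn.isPreconnected.subset_of_closure_inter_subset hGo ⟨x₀, hx₀, R₀, hR₀, hc⟩ ?_
    rintro x ⟨hxG, hxΩ⟩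
    obtain ⟨ρ, hρ, hB⟩ := Metric.nhds_basis_closedBall.mem_iff.1 (hΩ.mem_nhds hxΩ)
    obtain ⟨c', hc'⟩ := hloc x hρ hB
    obtain ⟨y, ⟨σ, hσ, hP⟩, hy⟩ := Metric.mem_closure_iff.1 hxG ρ hρ
    refine ⟨ρ, hρ, hP.trans hc' ?_ measure_closedBall_lt_top.ne⟩
    refine ne_of_gt (lt_of_lt_of_le
      (IsOpen.measure_pos volume (Metric.isOpen_ball.inter Metric.isOpen_ball)
        ⟨y, Metric.mem_ball_self hσ, Metric.mem_ball'.2 hy⟩)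
      (measure_mono (inter_subset_inter Metric.ball_subset_closedBall
        Metric.ball_subset_closedBall)))
  refine ⟨c, fun K hK hKc => ?_⟩
  refine hKc.induction_on (p := PoincareOn c) ⟨0, by simp, by simp⟩ (fun s t hst ht => ht.mono hst)
    (fun s t hs ht => hs.union ht) fun x hx => ?_
  obtain ⟨ρ, hρ, hP⟩ := hsub (hK hx)
  exact ⟨_, mem_nhdsWithin_of_mem_nhds (Metric.closedBall_mem_nhds x hρ), hP⟩

lemma integral_fn_eq_inner (hfin : volume Ω ≠ ⊤) (f : Lp ℂ 2 (volume.restrict Ω)) :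
    ∫ x in Ω, f x = inner ℂ (one hfin : SobolevW1 Ω 2).fn f := by
  rw [L2.inner_def]
  refine integral_congr_ae ?_
  filter_upwards [one_fn_ae (p := 2) hfin] with x hx
  rw [hx]
  simp

/-- Poincaré's inequality on a connected open set of finite measure for which `W^{1,2}` embeds
into `L^r` for some `r > 2`. -/
theorem exists_norm_le_energy_add_integral (hΩ : IsOpen Ω) (hconn : IsConnected Ω)
    (hfin : volume Ω ≠ ⊤) {r : ℝ} (hr : 2 < r)
    (hemb : ∀ u : SobolevW1 Ω 2, MemLp u.fn (ENNReal.ofReal r) (volume.restrict Ω)) :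
    ∃ C : ℝ, 0 < C ∧ ∀ u : SobolevW1 Ω 2, ‖u‖ ^ 2 ≤ C * (energy u + ‖∫ x in Ω, u.fn x‖ ^ 2) := by
  have : Fact (1 ≤ ENNReal.ofReal r) :=
    ⟨by rw [← ENNReal.ofReal_one]; exact ENNReal.ofReal_le_ofReal (by linarith)⟩
  obtain ⟨c, hc⟩ := exists_poincareOn hΩ hconn
  obtain ⟨S, hS, hSob⟩ := exists_eLpNorm_le hemb
  set e := (one hfin : SobolevW1 Ω 2) with he
  have hβ : 0 < 1 / 2 - 1 / r := by
    rw [sub_pos]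
    exact one_div_lt_one_div_of_lt two_pos hr
  -- outside a large compact set the `L²` norm is small compared with the Sobolev norm
  obtain ⟨K, hKΩ, hK, hsmall⟩ : ∃ K ⊆ Ω, IsCompact K ∧ ∀ w : SobolevW1 Ω 2,
      ∫⁻ x in Ω \ K, ‖w.fn x‖ₑ ^ 2 ≤ ENNReal.ofReal (1 / 2 * ‖w‖ ^ 2) := by
    -- Chosen so that $\delta^{1/2 - 1/r} = 1/(2S)$: on a set of measure below $\delta$, Hölder and
    -- the embedding give $\|w\|_2 \le \frac12\|w\|_{W^{1,2}}$.
    set δ : ℝ := (1 / (2 * S)) ^ (1 / (1 / 2 - 1 / r)) with hδ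
    have hδ0 : 0 < δ := by positivity
    obtain ⟨K, hKΩ, hK, hlt⟩ := hΩ.measurableSet.exists_isCompact_sdiff_lt hfin
      (ENNReal.ofReal_pos.2 hδ0).ne'
    refine ⟨K, hKΩ, hK, fun w => ?_⟩
    have hr2 : (2 : ℝ≥0∞) ≤ ENNReal.ofReal r := by
      rw [show (2 : ℝ≥0∞) = ENNReal.ofReal 2 by simp]
      exact ENNReal.ofReal_le_ofReal hr.le
    have h1 := eLpNorm_le_eLpNorm_mul_rpow_measure_univ (μ := volume.restrict (Ω \ K)) (f := w.fn)
      hr2 ((Lp.memLp w.fn).1.mono_measure (Measure.restrict_mono sdiff_subset le_rfl))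
    have h2 : eLpNorm w.fn (ENNReal.ofReal r) (volume.restrict (Ω \ K)) ≤ ENNReal.ofReal (S * ‖w‖) :=
      (eLpNorm_mono_measure _ (Measure.restrict_mono sdiff_subset le_rfl)).trans (hSob w)
    have h3 : volume.restrict (Ω \ K) univ ^ (1 / (2 : ℝ≥0∞).toReal - 1 / (ENNReal.ofReal r).toReal)
        ≤ ENNReal.ofReal (1 / (2 * S)) := by
      rw [Measure.restrict_apply_univ, ENNReal.toReal_ofReal (by linarith), ENNReal.toReal_ofNat]
      calc _ ≤ ENNReal.ofReal δ ^ (1 / 2 - 1 / r) := by gcongr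
        _ = _ := by
          rw [ENNReal.ofReal_rpow_of_pos hδ0, hδ, ← Real.rpow_mul (by positivity),
            one_div_mul_cancel hβ.ne', Real.rpow_one]
    have h4 : eLpNorm w.fn 2 (volume.restrict (Ω \ K)) ≤ ENNReal.ofReal (1 / 2 * ‖w‖) := by
      refine (h1.trans (mul_le_mul' h2 h3)).trans (le_of_eq ?_)
      rw [← ENNReal.ofReal_mul (by positivity)]
      congr 1
      field_simp
    have h5 := eLpNorm_nnreal_pow_eq_lintegral (f := w.fn) (μ := volume.restrict (Ω \ K)) (p := 2)
      two_ne_zero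
    have h6 : ∫⁻ x in Ω \ K, ‖w.fn x‖ₑ ^ 2 = eLpNorm w.fn 2 (volume.restrict (Ω \ K)) ^ 2 := by
      simpa using h5.symm
    rw [h6]
    calc _ ≤ ENNReal.ofReal (1 / 2 * ‖w‖) ^ 2 := by gcongr
      _ = ENNReal.ofReal ((1 / 2 * ‖w‖) ^ 2) := (ENNReal.ofReal_pow (by positivity) _).symm
      _ ≤ _ := ENNReal.ofReal_le_ofReal (by nlinarith [sq_nonneg ‖w‖])
  obtain ⟨C, hC, hP⟩ := hc K hKΩ hK
  set A := C.toReal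
  have hA : 0 ≤ A := ENNReal.toReal_nonneg
  -- the `L²` deviation from the constant is bounded by the energy
  have hdev : ∀ u : SobolevW1 Ω 2, ‖(u - c u • e).fn‖ ^ 2 ≤ (2 * A + 1) * energy u := by
    intro u
    set w := u - c u • e with hw
    have hgw : energy w = energy u := by
      refine Finset.sum_congr rfl fun j _ => ?_
      rw [hw, grad_sub, grad_smul, he, one_grad, smul_zero, sub_zero]
    have hwae : ∀ᵐ x ∂volume.restrict Ω, w.fn x = u.fn x - c u := by
      filter_upwards [Lp.coeFn_sub u.fn (c u • e.fn), Lp.coeFn_smul (c u) e.fn,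
        one_fn_ae (p := 2) hfin] with x h1 h2 h3
      rw [hw, fn_sub, fn_smul, h1, Pi.sub_apply, h2, Pi.smul_apply, he, h3]
      simp
    have h1 : ∫⁻ x in K, ‖w.fn x‖ₑ ^ 2 ≤ ENNReal.ofReal (A * energy u) := by
      rw [ENNReal.ofReal_mul hA, ENNReal.ofReal_toReal hC]
      refine le_trans (le_of_eq (lintegral_congr_ae ?_)) (hP u)
      filter_upwards [ae_mono (Measure.restrict_mono hKΩ le_rfl) hwae] with x hx
      rw [hx]
    have h2 : ENNReal.ofReal (‖w.fn‖ ^ 2) ≤ ENNReal.ofReal (A * energy u + 1 / 2 * ‖w‖ ^ 2) := by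
      rw [ENNReal.ofReal_add (mul_nonneg hA (energy_nonneg u)) (by positivity),
        ← lintegral_enorm_sq_eq]
      calc ∫⁻ x in Ω, ‖w.fn x‖ₑ ^ 2 ≤ ∫⁻ x in K ∪ Ω \ K, ‖w.fn x‖ₑ ^ 2 :=
            lintegral_mono_set (union_sdiff_cancel hKΩ).ge
        _ ≤ _ := lintegral_union_le _ _ _
        _ ≤ _ := add_le_add h1 (hsmall w)
    rw [ENNReal.ofReal_le_ofReal_iff (by have := energy_nonneg u; positivity), norm_sq] at h2
    change _ ≤ A * energy u + 1 / 2 * (‖w.fn‖ ^ 2 + energy w) at h2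
    -- Half of the squared $L^2$ norm moves to the left-hand side, which produces $2A + 1$.
    rw [hgw] at h2
    linarith
  set m := ‖e.fn‖
  have hm : 0 < m := by
    rw [norm_pos_iff]
    intro h0
    have h1 : ∀ᵐ x ∂volume.restrict Ω, False := by
      filter_upwards [one_fn_ae (p := 2) hfin, Lp.coeFn_zero ℂ 2 (volume.restrict Ω)] with x h1 h2
      rw [← he, h0, h2] at h1
      exact zero_ne_one h1
    rw [eventually_false_iff_eq_bot, ae_eq_bot, Measure.restrict_eq_zero] at h1
    exact (hΩ.measure_pos volume hconn.nonempty).ne' h1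
  -- With $m = \|\mathbf 1\|_2$ and $w = u - c(u)$, the integral determines $c(u)$ up to $w$:
  -- $|c(u)|\,m^2 \le |\int u| + m\|w\|_2$. Hence $m\|u\|_2 \le 2m\|w\|_2 + |\int u|$; squaring
  -- gives the `8` and the `2`, and the `1` is the energy itself.
  refine ⟨8 * (2 * A + 1) + 1 + 2 / m ^ 2, by positivity, fun u => ?_⟩
  set w := u - c u • e with hw
  have hfn : u.fn = w.fn + c u • e.fn := by
    rw [hw, fn_sub, fn_smul, sub_add_cancel]
  have hI : ∫ x in Ω, u.fn x = inner ℂ e.fn w.fn + c u * (m ^ 2 : ℝ) := by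
    rw [integral_fn_eq_inner hfin, ← he, hfn, inner_add_right, inner_smul_right,
      inner_self_eq_norm_sq_to_K]
    simp [m]
  have hcI : ‖c u‖ * m ^ 2 ≤ ‖∫ x in Ω, u.fn x‖ + m * ‖w.fn‖ := by
    have h1 : c u * (m ^ 2 : ℝ) = (∫ x in Ω, u.fn x) - inner ℂ e.fn w.fn := by rw [hI]; ring
    calc ‖c u‖ * m ^ 2 = ‖c u * (m ^ 2 : ℝ)‖ := by
          rw [norm_mul, Complex.norm_real, Real.norm_of_nonneg (by positivity)]
      _ ≤ ‖∫ x in Ω, u.fn x‖ + ‖inner ℂ e.fn w.fn‖ := by rw [h1]; exact norm_sub_le _ _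
      _ ≤ _ := by gcongr; exact norm_inner_le_norm _ _
  have hfnle : ‖u.fn‖ ≤ ‖w.fn‖ + ‖c u‖ * m := by
    rw [hfn]
    exact (norm_add_le _ _).trans (by rw [norm_smul])
  set I := ‖∫ x in Ω, u.fn x‖
  have h1 : m * ‖u.fn‖ ≤ 2 * (m * ‖w.fn‖) + I := by nlinarith
  have h2 : (m * ‖u.fn‖) ^ 2 ≤ 8 * (m * ‖w.fn‖) ^ 2 + 2 * I ^ 2 := by
    have h3 : (m * ‖u.fn‖) ^ 2 ≤ (2 * (m * ‖w.fn‖) + I) ^ 2 := by gcongr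
    nlinarith [sq_nonneg (2 * (m * ‖w.fn‖) - I)]
  have h4 : ‖u.fn‖ ^ 2 ≤ 8 * ‖w.fn‖ ^ 2 + 2 / m ^ 2 * I ^ 2 := by
    rw [mul_pow, mul_pow] at h2
    refine le_of_mul_le_mul_left (h2.trans (le_of_eq ?_)) (show 0 < m ^ 2 by positivity)
    field_simp
  have h5 := hdev u
  rw [norm_sq]
  change _ + energy u ≤ _
  have h6 : 0 ≤ 2 / m ^ 2 * energy u := mul_nonneg (by positivity) (energy_nonneg u)
  have h7 : 0 ≤ (8 * (2 * A + 1) + 1) * I ^ 2 := by positivity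
  nlinarith

end GlobalPoincare

end SobolevW1

/-! ### Lax–Milgram -/

section LaxMilgram

/-- The Lax–Milgram theorem for sesquilinear forms on complex Hilbert spaces. -/
theorem exists_apply_eq_of_coercive {V : Type*} [NormedAddCommGroup V] [InnerProductSpace ℂ V]
    [CompleteSpace V] (B : V →L⋆[ℂ] V →L[ℂ] ℂ) {c : ℝ} (hc : 0 < c)
    (hB : ∀ v, c * ‖v‖ ^ 2 ≤ (B v v).re) (f : V →L[ℂ] ℂ) : ∃ u, ∀ v, B u v = f v := by
  set T := InnerProductSpace.continuousLinearMapOfBilin (𝕜 := ℂ) B with hT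
  have hTB : ∀ u v, inner ℂ (T u) v = B u v :=
    fun u v => InnerProductSpace.continuousLinearMapOfBilin_apply B u v
  have hbelow : ∀ v, c * ‖v‖ ≤ ‖T v‖ := by
    intro v
    rcases (norm_nonneg v).eq_or_lt with h | h
    · rw [← h, mul_zero]; exact norm_nonneg _
    · refine le_of_mul_le_mul_right ?_ h
      calc c * ‖v‖ * ‖v‖ = c * ‖v‖ ^ 2 := by ring
        _ ≤ (inner ℂ (T v) v).re := by rw [hTB]; exact hB v
        _ ≤ ‖inner ℂ (T v) v‖ := Complex.re_le_norm _
        _ ≤ ‖T v‖ * ‖v‖ := norm_inner_le_norm _ _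
  have hanti : AntilipschitzWith (c⁻¹).toNNReal T := by
    refine T.antilipschitz_of_bound fun v => ?_
    rw [Real.coe_toNNReal _ (inv_nonneg.2 hc.le), ← div_eq_inv_mul, le_div_iff₀ hc, mul_comm]
    exact hbelow v
  have hclosed : IsClosed (T.range : Set V) := hanti.isClosed_range T.uniformContinuous
  -- The range is closed, and a vector $w$ orthogonal to it satisfies $B(w,w) = 0$, so coercivity
  -- forces $w = 0$.
  have htop : T.range = ⊤ := by
    have := hclosed.completeSpace_coe
    rw [← T.range.orthogonal_orthogonal, Submodule.eq_top_iff']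
    intro v w hw
    have h0 : (B w w).re = 0 := by
      have h00 : inner ℂ (T w) w = 0 := hw _ ⟨w, rfl⟩
      rw [← hTB, h00, Complex.zero_re]
    have h1 := hB w
    rw [h0] at h1
    have h2 : ‖w‖ ^ 2 ≤ 0 := by
      by_contra h
      push Not at h
      exact absurd h1 (not_le.2 (mul_pos hc h))
    have h3 : w = 0 := norm_eq_zero.1 (pow_eq_zero_iff two_ne_zero |>.1
      (le_antisymm h2 (sq_nonneg _)))
    rw [h3, inner_zero_left]
  obtain ⟨u, hu⟩ : (InnerProductSpace.toDual ℂ V).symm f ∈ T.range := htop ▸ Submodule.mem_top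
  refine ⟨u, fun v => ?_⟩
  rw [← hTB, show T u = (InnerProductSpace.toDual ℂ V).symm f from hu,
    InnerProductSpace.toDual_symm_apply]

/-- The Lax–Milgram theorem for a form that is coercive up to a functional. -/
theorem exists_apply_add_inner_eq_of_coercive {V : Type*} [NormedAddCommGroup V]
    [InnerProductSpace ℂ V] [CompleteSpace V] (B : V →L⋆[ℂ] V →L[ℂ] ℂ) (m : V →L[ℂ] ℂ) {c : ℝ}
    (hc : 0 < c) (hB : ∀ v, c * ‖v‖ ^ 2 ≤ (B v v).re + ‖m v‖ ^ 2) (f : V →L[ℂ] ℂ) :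
    ∃ u, ∀ v, B u v + inner ℂ (m u) (m v) = f v := by
  refine exists_apply_eq_of_coercive (B + (innerSL ℂ).bilinearComp m m) hc (fun v => ?_) f
  have h1 : (B + (innerSL ℂ).bilinearComp m m) v v = B v v + inner ℂ (m v) (m v) := rfl
  rw [h1, Complex.add_re, inner_self_eq_norm_sq_to_K]
  refine (hB v).trans (le_of_eq ?_)
  norm_cast

/-- The Neumann form is linear in its first argument and antilinear in its second, so its conjugate
is the map that fits Lax–Milgram; here additivity is carried back to the form. -/
lemma map_sub_left_of_apply_eq_conj {V : Type*} [NormedAddCommGroup V] [NormedSpace ℂ V]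
    (B : V →L⋆[ℂ] V →L[ℂ] ℂ) {a : V → V → ℂ} (h : ∀ u v, B u v = conj (a u v)) (u u' v : V) :
    a (u - u') v = a u v - a u' v := by
  apply (starRingEnd ℂ).injective
  rw [map_sub (starRingEnd ℂ), ← h, ← h, ← h, map_sub, sub_apply]

lemma map_smul_left_of_apply_eq_conj {V : Type*} [NormedAddCommGroup V] [NormedSpace ℂ V]
    (B : V →L⋆[ℂ] V →L[ℂ] ℂ) {a : V → V → ℂ} (h : ∀ u v, B u v = conj (a u v)) (c : ℂ) (u v : V) :
    a (c • u) v = c * a u v := by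
  apply (starRingEnd ℂ).injective
  rw [map_mul (starRingEnd ℂ), ← h, ← h, map_smulₛₗ, smul_apply, smul_eq_mul]

end LaxMilgram

/-! ### The Neumann form: boundedness and coercivity -/

namespace SobolevW1

section Form

variable {d : ℕ} {Ω : Set (EuclideanSpace ℝ (Fin d))}
  {μ : EuclideanSpace ℝ (Fin d) → Matrix (Fin d) (Fin d) ℝ}

lemma memLp_coeff (hμ_meas : ∀ k l, AEMeasurable (fun x => μ x k l) (volume.restrict Ω))
    (hμ_bdd : ∃ M : ℝ, ∀ᵐ x ∂(volume.restrict Ω), ∀ k l, |μ x k l| ≤ M) (k l : Fin d) :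
    MemLp (fun x => (μ x k l : ℂ)) ⊤ (volume.restrict Ω) := by
  obtain ⟨M, hM⟩ := hμ_bdd
  refine memLp_top_of_bound
    (Complex.continuous_ofReal.comp_aestronglyMeasurable (hμ_meas k l).aestronglyMeasurable) M ?_
  filter_upwards [hM] with x hx
  rw [Complex.norm_real]
  exact hx k l

lemma exists_mul_operator (hμ_meas : ∀ k l, AEMeasurable (fun x => μ x k l) (volume.restrict Ω))
    (hμ_bdd : ∃ M : ℝ, ∀ᵐ x ∂(volume.restrict Ω), ∀ k l, |μ x k l| ≤ M) (k l : Fin d) :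
    ∃ L : Lp ℂ 2 (volume.restrict Ω) →L[ℂ] Lp ℂ 2 (volume.restrict Ω),
      ∀ f, ∀ᵐ x ∂volume.restrict Ω, L f x = (μ x k l : ℂ) * f x := by
  have hm := memLp_coeff hμ_meas hμ_bdd k l
  refine ⟨(ContinuousLinearMap.mul ℂ ℂ).holderL (volume.restrict Ω) ⊤ 2 2 (hm.toLp _), fun f => ?_⟩
  have h := ContinuousLinearMap.coeFn_holder (r := 2) (ContinuousLinearMap.mul ℂ ℂ) (hm.toLp _) f
  filter_upwards [h, hm.coeFn_toLp] with x h1 h2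
  refine h1.trans ?_
  rw [h2]
  rfl

/-- The form is given by a bounded sesquilinear map, with an integrable density. -/
theorem exists_sesqForm (hμ_meas : ∀ k l, AEMeasurable (fun x => μ x k l) (volume.restrict Ω))
    (hμ_bdd : ∃ M : ℝ, ∀ᵐ x ∂(volume.restrict Ω), ∀ k l, |μ x k l| ≤ M) :
    (∀ u v : SobolevW1 Ω 2, Integrable
      (fun x => ∑ k, (∑ l, (μ x k l : ℂ) * u.grad l x) * conj (v.grad k x)) (volume.restrict Ω)) ∧
    ∃ B : SobolevW1 Ω 2 →L⋆[ℂ] SobolevW1 Ω 2 →L[ℂ] ℂ,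
      ∀ u v, B u v = conj (neumannForm μ u v) := by
  choose L hL using exists_mul_operator hμ_meas hμ_bdd
  have hae : ∀ u v : SobolevW1 Ω 2,
      (fun x => ∑ k, ∑ l, inner ℂ (v.grad k x) (L k l (u.grad l) x)) =ᵐ[volume.restrict Ω]
      fun x => ∑ k, (∑ l, (μ x k l : ℂ) * u.grad l x) * conj (v.grad k x) := by
    intro u v
    have : ∀ᵐ x ∂volume.restrict Ω, ∀ k l, L k l (u.grad l) x = (μ x k l : ℂ) * u.grad l x :=
      ae_all_iff.2 fun k => ae_all_iff.2 fun l => hL k l _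
    filter_upwards [this] with x hx
    refine Finset.sum_congr rfl fun k _ => ?_
    rw [Finset.sum_mul]
    refine Finset.sum_congr rfl fun l _ => ?_
    rw [hx k l]
    simp
  have hint : ∀ (u v : SobolevW1 Ω 2) (k l : Fin d),
      Integrable (fun x => inner ℂ (v.grad k x) (L k l (u.grad l) x)) (volume.restrict Ω) :=
    fun u v k l => L2.integrable_inner _ _
  refine ⟨fun u v => ?_, ?_⟩
  · exact (integrable_finsetSum _ fun k _ => integrable_finsetSum _ fun l _ => hint u v k l).congr
      (hae u v)
  · have hB : ∀ k l, ∃ b : SobolevW1 Ω 2 →L⋆[ℂ] SobolevW1 Ω 2 →L[ℂ] ℂ,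
        ∀ u v, b u v = inner ℂ (L k l (u.grad l)) (v.grad k) := fun k l =>
      ⟨(innerSL ℂ).bilinearComp ((L k l).comp (gradL Ω 2 l)) (gradL Ω 2 k), fun _ _ => rfl⟩
    choose b hb using hB
    refine ⟨∑ k, ∑ l, b k l, fun u v => ?_⟩
    have h1 : neumannForm μ u v = ∑ k, ∑ l, inner ℂ (v.grad k) (L k l (u.grad l)) := by
      rw [neumannForm, ← integral_congr_ae (hae u v), integral_finsetSum _ fun k _ =>
        integrable_finsetSum _ fun l _ => hint u v k l]
      refine Finset.sum_congr rfl fun k _ => ?_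
      rw [integral_finsetSum _ fun l _ => hint u v k l]
      exact Finset.sum_congr rfl fun l _ => (L2.inner_def _ _).symm
    have h2 : (∑ k, ∑ l, b k l) u v = ∑ k, ∑ l, b k l u v := by
      simp only [sum_apply]
    rw [h2, h1, map_sum (starRingEnd ℂ)]
    refine Finset.sum_congr rfl fun k _ => ?_
    rw [map_sum (starRingEnd ℂ)]
    refine Finset.sum_congr rfl fun l _ => ?_
    rw [hb, inner_conj_symm]

lemma integral_sum_norm_sq_grad (v : SobolevW1 Ω 2) :
    Integrable (fun x => ∑ k, ‖v.grad k x‖ ^ 2) (volume.restrict Ω) ∧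
    ∫ x in Ω, ∑ k, ‖v.grad k x‖ ^ 2 = energy v := by
  have hint : ∀ k, Integrable (fun x => ‖v.grad k x‖ ^ 2) (volume.restrict Ω) := fun k =>
    (memLp_two_iff_integrable_sq_norm (Lp.memLp (v.grad k)).1).1 (Lp.memLp (v.grad k))
  refine ⟨integrable_finsetSum _ fun k _ => hint k, ?_⟩
  rw [integral_finsetSum _ fun k _ => hint k, energy]
  refine Finset.sum_congr rfl fun k _ => ?_
  rw [integral_eq_lintegral_of_nonneg_ae (Eventually.of_forall fun x => by positivity)
    (hint k).1]
  have : ∀ x, ENNReal.ofReal (‖v.grad k x‖ ^ 2) = ‖v.grad k x‖ₑ ^ 2 := fun x => by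
    rw [ENNReal.ofReal_pow (norm_nonneg _), ofReal_norm]
  simp only [this]
  rw [lintegral_enorm_sq_eq, ENNReal.toReal_ofReal (by positivity)]

/-- A pointwise lower bound for the density of the form gives a bound by the energy. -/
lemma mul_energy_le_re_neumannForm
    (hμ_meas : ∀ k l, AEMeasurable (fun x => μ x k l) (volume.restrict Ω))
    (hμ_bdd : ∃ M : ℝ, ∀ᵐ x ∂(volume.restrict Ω), ∀ k l, |μ x k l| ≤ M) {ν : ℝ}
    {u v : SobolevW1 Ω 2} (h : ∀ᵐ x ∂volume.restrict Ω, ν * ∑ k, ‖v.grad k x‖ ^ 2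
      ≤ (∑ k, (∑ l, (μ x k l : ℂ) * u.grad l x) * conj (v.grad k x)).re) :
    ν * energy v ≤ (neumannForm μ u v).re := by
  have hint := (exists_sesqForm hμ_meas hμ_bdd).1 u v
  obtain ⟨h1, h2⟩ := integral_sum_norm_sq_grad v
  rw [← h2, ← integral_const_mul, neumannForm, ← RCLike.re_eq_complex_re, ← integral_re hint]
  exact integral_mono_ae (h1.const_mul ν) hint.re h

/-- Coercivity of the form with respect to the energy. -/
lemma mul_energy_le_re_neumannForm_self
    (hμ_meas : ∀ k l, AEMeasurable (fun x => μ x k l) (volume.restrict Ω))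
    (hμ_bdd : ∃ M : ℝ, ∀ᵐ x ∂(volume.restrict Ω), ∀ k l, |μ x k l| ≤ M) {ν : ℝ}
    (hν : ∀ᵐ x ∂(volume.restrict Ω), ∀ ξ : Fin d → ℂ,
      ν * ∑ k, ‖ξ k‖ ^ 2 ≤ (∑ k, ∑ l, (μ x k l : ℂ) * ξ k * conj (ξ l)).re)
    (u : SobolevW1 Ω 2) : ν * energy u ≤ (neumannForm μ u u).re := by
  refine mul_energy_le_re_neumannForm hμ_meas hμ_bdd ?_
  filter_upwards [hν] with x hx
  -- Ellipticity conjugates the column index of $\mu$ while the form conjugates the row index;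
  -- inserting $\overline{\nabla u}$ reconciles the two.
  have := hx fun k => conj (u.grad k x)
  simp only [RCLike.norm_conj, Complex.conj_conj] at this
  refine this.trans (le_of_eq ?_)
  congr 1
  refine Finset.sum_congr rfl fun k _ => ?_
  rw [Finset.sum_mul]
  exact Finset.sum_congr rfl fun l _ => by ring

/-- Coercivity of the form for truncations. -/
lemma mul_energy_le_re_neumannForm_truncation
    (hμ_meas : ∀ k l, AEMeasurable (fun x => μ x k l) (volume.restrict Ω))
    (hμ_bdd : ∃ M : ℝ, ∀ᵐ x ∂(volume.restrict Ω), ∀ k l, |μ x k l| ≤ M) {ν : ℝ}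
    (hν : ∀ᵐ x ∂(volume.restrict Ω), ∀ ξ : Fin d → ℂ,
      ν * ∑ k, ‖ξ k‖ ^ 2 ≤ (∑ k, ∑ l, (μ x k l : ℂ) * ξ k * conj (ξ l)).re)
    {u v : SobolevW1 Ω 2} {k : ℝ} (hv : ∀ j, ∀ᵐ x ∂volume.restrict Ω,
        v.grad j x = if k < (u.fn x).re then ((u.grad j x).re : ℂ) else 0) :
    ν * energy v ≤ (neumannForm μ u v).re := by
  refine mul_energy_le_re_neumannForm hμ_meas hμ_bdd ?_
  filter_upwards [hν, ae_all_iff.2 hv] with x hx hvx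
  simp only [hvx]
  split_ifs with hk
  -- Here the reality of $\mu$ enters: with $\nabla v = \operatorname{Re} \nabla u$ real, taking the
  -- real part of the density replaces $\nabla u$ by $\nabla v$.
  · refine (hx fun k => ((u.grad k x).re : ℂ)).trans (le_of_eq ?_)
    simp only [Complex.re_sum, Complex.conj_ofReal, Finset.sum_mul, ← Complex.ofReal_mul,
      Complex.ofReal_re]
    refine Finset.sum_congr rfl fun k _ => Finset.sum_congr rfl fun l _ => ?_
    rw [Complex.re_mul_ofReal, Complex.re_ofReal_mul]
    ring
  · simp

end Form

/-! ### The inclusion of $W^{1,2}$ in $W^{1,p}$ -/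

section Incl

variable {d : ℕ} {Ω : Set (EuclideanSpace ℝ (Fin d))} {p : ℝ≥0∞} [Fact (1 ≤ p)]

lemma incl_fn_ae (hfin : volume Ω ≠ ⊤) (hp : p ≤ 2) (u : SobolevW1 Ω 2) :
    (incl hfin hp u).fn =ᵐ[volume.restrict Ω] u.fn := mk_fn_ae ..

lemma incl_grad_ae (hfin : volume Ω ≠ ⊤) (hp : p ≤ 2) (u : SobolevW1 Ω 2) (j : Fin d) :
    (incl hfin hp u).grad j =ᵐ[volume.restrict Ω] u.grad j := mk_grad_ae ..

/-- The inclusion is built from representatives. Weak gradients on an open set are determined by the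
function, so it suffices to compare functions. -/
lemma incl_add (hΩ : IsOpen Ω) (hfin : volume Ω ≠ ⊤) (hp : p ≤ 2) (u v : SobolevW1 Ω 2) :
    incl hfin hp (u + v) = incl hfin hp u + incl hfin hp v := by
  refine fn_injective hΩ (Lp.ext ?_)
  filter_upwards [incl_fn_ae hfin hp (u + v), incl_fn_ae hfin hp u, incl_fn_ae hfin hp v,
    Lp.coeFn_add u.fn v.fn, Lp.coeFn_add (incl hfin hp u).fn (incl hfin hp v).fn]
    with x h1 h2 h3 h4 h5
  rw [h1, fn_add, fn_add, h4, h5, Pi.add_apply, Pi.add_apply, h2, h3]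

lemma incl_smul (hΩ : IsOpen Ω) (hfin : volume Ω ≠ ⊤) (hp : p ≤ 2) (c : ℂ) (u : SobolevW1 Ω 2) :
    incl hfin hp (c • u) = c • incl hfin hp u := by
  refine fn_injective hΩ (Lp.ext ?_)
  filter_upwards [incl_fn_ae hfin hp (c • u), incl_fn_ae hfin hp u,
    Lp.coeFn_smul c u.fn, Lp.coeFn_smul c (incl hfin hp u).fn] with x h1 h2 h3 h4
  rw [h1, fn_smul, fn_smul, h3, h4, Pi.smul_apply, Pi.smul_apply, h2]

lemma incl_one (hΩ : IsOpen Ω) (hfin : volume Ω ≠ ⊤) (hp : p ≤ 2) :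
    incl hfin hp (one hfin) = one hfin := by
  refine fn_injective hΩ (Lp.ext ?_)
  filter_upwards [incl_fn_ae hfin hp (one hfin), one_fn_ae (p := 2) hfin, one_fn_ae (p := p) hfin]
    with x h1 h2 h3
  rw [h1, h2, h3]

/-- Hölder's inequality for functions vanishing off a set. -/
lemma _root_.eLpNorm_le_of_ae_eq_zero_off {α : Type*} [MeasurableSpace α] {m : Measure α}
    [IsFiniteMeasure m] {p s : ℝ≥0∞} (hp : 1 ≤ p) (hs : s ≠ ⊤) (hps : p ≤ s) {f : α → ℂ}
    (hf : AEStronglyMeasurable f m) {A : Set α} (hA : MeasurableSet A)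
    (hfA : ∀ᵐ x ∂m, x ∉ A → f x = 0) :
    eLpNorm f p m ≤ eLpNorm f s m * ENNReal.ofReal (m.real A ^ (1 / p.toReal - 1 / s.toReal)) := by
  have hind : f =ᵐ[m] A.indicator f := by
    filter_upwards [hfA] with x hx
    by_cases h : x ∈ A
    · rw [indicator_of_mem h]
    · rw [indicator_of_notMem h, hx h]
  have hp' : 0 < p.toReal := ENNReal.toReal_pos (zero_lt_one.trans_le hp).ne'
    (ne_top_of_le_ne_top hs hps)
  have he : 0 ≤ 1 / p.toReal - 1 / s.toReal :=
    sub_nonneg.2 (one_div_le_one_div_of_le hp' (ENNReal.toReal_mono hs hps))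
  calc eLpNorm f p m = eLpNorm f p (m.restrict A) := by
        rw [eLpNorm_congr_ae hind, eLpNorm_indicator_eq_eLpNorm_restrict hA]
    _ ≤ eLpNorm f s (m.restrict A) * m.restrict A univ ^ (1 / p.toReal - 1 / s.toReal) :=
      eLpNorm_le_eLpNorm_mul_rpow_measure_univ hps hf.restrict
    _ ≤ _ := by
      rw [Measure.restrict_apply_univ, ← ENNReal.ofReal_rpow_of_nonneg measureReal_nonneg he,
        ofReal_measureReal]
      gcongr
      exact Measure.restrict_le_self

/-- The norm of the inclusion on functions vanishing off a set. -/
lemma norm_incl_le (hfin : volume Ω ≠ ⊤) (hp : p ≤ 2) (u : SobolevW1 Ω 2)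
    {A : Set (EuclideanSpace ℝ (Fin d))} (hA : MeasurableSet A)
    (hfn : ∀ᵐ x ∂volume.restrict Ω, x ∉ A → u.fn x = 0)
    (hgrad : ∀ j, ∀ᵐ x ∂volume.restrict Ω, x ∉ A → u.grad j x = 0) :
    ‖incl hfin hp u‖ ≤ (d + 1) * (volume.restrict Ω).real A ^ (1 / p.toReal - 1 / 2) * ‖u‖ := by
  have : IsFiniteMeasure (volume.restrict Ω) := isFiniteMeasure_restrict.2 hfin
  set a := (volume.restrict Ω).real A ^ (1 / p.toReal - 1 / 2) with ha
  have ha0 : 0 ≤ a := by positivity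
  have key : ∀ (f : Lp ℂ p (volume.restrict Ω)) (g : Lp ℂ 2 (volume.restrict Ω)),
      f =ᵐ[volume.restrict Ω] g → (∀ᵐ x ∂volume.restrict Ω, x ∉ A → g x = 0) →
      ‖f‖ ≤ ‖g‖ * a := by
    intro f g hfg hg
    have h := eLpNorm_le_of_ae_eq_zero_off (p := p) (s := 2) Fact.out (by simp) hp
      (Lp.memLp g).1 hA hg
    rw [ENNReal.toReal_ofNat, ← ha, ← eLpNorm_congr_ae hfg, ← Lp.enorm_def, ← Lp.enorm_def,
      ← ofReal_norm, ← ofReal_norm, ← ENNReal.ofReal_mul (norm_nonneg _),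
      ENNReal.ofReal_le_ofReal_iff (by positivity)] at h
    exact h
  calc ‖incl hfin hp u‖ ≤ ‖(incl hfin hp u).fn‖ + ∑ j, ‖(incl hfin hp u).grad j‖ := norm_le_sum _
    _ ≤ ‖u‖ * a + ∑ _j : Fin d, ‖u‖ * a := by
      refine add_le_add ((key _ _ (incl_fn_ae hfin hp u) hfn).trans ?_)
        (Finset.sum_le_sum fun j _ => (key _ _ (incl_grad_ae hfin hp u j) (hgrad j)).trans ?_)
      · exact mul_le_mul_of_nonneg_right (norm_fn_le u) ha0
      · exact mul_le_mul_of_nonneg_right (norm_grad_le u j) ha0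
    _ = _ := by
      rw [Finset.sum_const, Finset.card_univ, Fintype.card_fin, nsmul_eq_mul]
      ring

lemma exists_norm_incl_le (hfin : volume Ω ≠ ⊤) (hp : p ≤ 2) :
    ∃ C : ℝ, 0 < C ∧ ∀ u : SobolevW1 Ω 2, ‖incl hfin hp u‖ ≤ C * ‖u‖ := by
  refine ⟨(d + 1) * (volume.restrict Ω).real univ ^ (1 / p.toReal - 1 / 2) + 1, by positivity,
    fun u => (norm_incl_le hfin hp u MeasurableSet.univ (by simp) (by simp)).trans ?_⟩
  gcongr
  linarith

/-- Elements of the antidual of `W^{1,p}(Ω)` are bounded on `W^{1,2}(Ω)`. -/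
lemma exists_clm_conj_incl (hΩ : IsOpen Ω) (hfin : volume Ω ≠ ⊤) (hp : p ≤ 2)
    (T : SobolevDual Ω p) :
    ∃ f : SobolevW1 Ω 2 →L[ℂ] ℂ, ∀ v, f v = conj (T (incl hfin hp v)) := by
  obtain ⟨C, -, hC⟩ := exists_norm_incl_le (Ω := Ω) hfin hp
  let f : SobolevW1 Ω 2 →ₗ[ℂ] ℂ :=
    { toFun := fun v => conj (T (incl hfin hp v))
      map_add' := fun v w => by rw [incl_add hΩ, map_add T, map_add (starRingEnd ℂ)]
      map_smul' := fun a v => by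
        rw [incl_smul hΩ, map_smulₛₗ T, smul_eq_mul, map_mul (starRingEnd ℂ), Complex.conj_conj]
        rfl }
  refine ⟨f.mkContinuous (‖T‖ * C) fun v => ?_, fun v => rfl⟩
  change ‖conj (T (incl hfin hp v))‖ ≤ _
  rw [RCLike.norm_conj, mul_assoc]
  exact (T.le_opNorm _).trans (mul_le_mul_of_nonneg_left (hC v) T.opNorm_nonneg)

end Incl

end SobolevW1

/-! ### Iteration and Chebyshev -/

/-- Stampacchia's iteration lemma. -/
lemma eq_zero_of_stampacchia {b : ℝ → ℝ} (hb : ∀ k, 0 ≤ b k) (hanti : Antitone b) {k₀ M B γ : ℝ}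
    (hM : 0 < M) (hB : 0 < B) (hγ : 1 < γ) (hk₀ : b k₀ ≤ B)
    (h : ∀ k h, k₀ ≤ k → k < h → (h - k) * b h ≤ M * b k ^ γ) :
    b (k₀ + 2 * M * B ^ (γ - 1) * 2 ^ (1 / (γ - 1))) = 0 := by
  have hγ1 : 0 < γ - 1 := sub_pos.2 hγ
  -- The decay ratio with $\lambda^\gamma = \lambda/2$: the extra factor $\frac12$ pays for halving
  -- the distance between consecutive levels.
  set lam : ℝ := (1 / 2) ^ (1 / (γ - 1)) with hlam
  have hlam0 : 0 < lam := by positivity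
  have hlam1 : lam < 1 := Real.rpow_lt_one (by norm_num) (by norm_num) (by positivity)
  have hlamγ : lam ^ γ = lam * (1 / 2) := by
    have : lam ^ (γ - 1) = 1 / 2 := by
      rw [hlam, ← Real.rpow_mul (by norm_num), one_div_mul_cancel hγ1.ne', Real.rpow_one]
    rw [← this, ← Real.rpow_one_add' hlam0.le (by linarith)]
    congr 1; ring
  have h2lam : (2 : ℝ) ^ (1 / (γ - 1)) * lam = 1 := by
    rw [hlam, ← Real.mul_rpow (by norm_num) (by norm_num)]
    norm_num
  -- The total rise for which $D\lambda = 2MB^{\gamma-1}$, so that $b \le B\lambda^n$ at level $k_0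
  -- + D(1 - 2^{-n})$ reproduces itself exactly.
  set D := 2 * M * B ^ (γ - 1) * 2 ^ (1 / (γ - 1)) with hD
  have hD0 : 0 < D := by positivity
  have hDlam : D * lam = 2 * M * B ^ (γ - 1) := by rw [hD, mul_assoc, h2lam, mul_one]
  have hBγ : B ^ γ = B ^ (γ - 1) * B := by
    rw [← Real.rpow_add_one hB.ne']
    congr 1; ring
  have hind : ∀ n : ℕ, b (k₀ + D * (1 - (1 / 2) ^ n)) ≤ B * lam ^ n := by
    intro n
    induction n with
    | zero => simpa using hk₀
    | succ n ih =>
      set k := k₀ + D * (1 - (1 / 2) ^ n) with hk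
      have hpow : (0 : ℝ) < (1 / 2) ^ n := by positivity
      have hpow1 : ((1 : ℝ) / 2) ^ n ≤ 1 := pow_le_one₀ (by norm_num) (by norm_num)
      have hdiff : k₀ + D * (1 - (1 / 2) ^ (n + 1)) - k = D * (1 / 2) ^ n / 2 := by
        rw [hk, pow_succ]; ring
      have h1 := h k (k₀ + D * (1 - (1 / 2) ^ (n + 1)))
        (le_add_of_nonneg_right (mul_nonneg hD0.le (by linarith)))
        (by rw [← sub_pos, hdiff]; positivity)
      rw [hdiff] at h1
      have h2 : b k ^ γ ≤ B ^ (γ - 1) * B * (lam ^ n * (1 / 2) ^ n) := by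
        calc b k ^ γ ≤ (B * lam ^ n) ^ γ := Real.rpow_le_rpow (hb k) ih (by linarith)
          _ = B ^ γ * (lam ^ γ) ^ n := by
            rw [Real.mul_rpow hB.le (by positivity), ← Real.rpow_natCast, ← Real.rpow_natCast,
              ← Real.rpow_mul hlam0.le, ← Real.rpow_mul hlam0.le, mul_comm γ]
          _ = _ := by rw [hBγ, hlamγ, mul_pow]
      have h3 : D * (1 / 2) ^ n / 2 * b (k₀ + D * (1 - (1 / 2) ^ (n + 1)))
          ≤ D * (1 / 2) ^ n / 2 * (B * lam ^ (n + 1)) := by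
        calc _ ≤ M * b k ^ γ := h1
          _ ≤ M * (B ^ (γ - 1) * B * (lam ^ n * (1 / 2) ^ n)) := by gcongr
          _ = (2 * M * B ^ (γ - 1)) * (B * lam ^ n * (1 / 2) ^ n) / 2 := by ring
          _ = _ := by rw [← hDlam, pow_succ]; ring
      exact le_of_mul_le_mul_left h3 (by positivity)
  have hlim : Tendsto (fun n : ℕ => B * lam ^ n) atTop (𝓝 (B * 0)) :=
    (tendsto_pow_atTop_nhds_zero_of_lt_one hlam0.le hlam1).const_mul B
  rw [mul_zero] at hlim
  refine le_antisymm (ge_of_tendsto' hlim fun n => (hanti ?_).trans (hind n)) (hb _)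
  have : (0 : ℝ) ≤ (1 / 2) ^ n := by positivity
  nlinarith

/-- Chebyshev's inequality for superlevel sets of the real part. -/
lemma mul_measureReal_rpow_le_of_eLpNorm_le {α : Type*} [MeasurableSpace α] {m : Measure α}
    [IsFiniteMeasure m] {f : α → ℂ} (hf : AEStronglyMeasurable f m) {s : ℝ} (hs : 0 < s) {t N : ℝ}
    (ht : 0 ≤ t) (hN : 0 ≤ N) {A : Set α} (hA : ∀ᵐ x ∂m, x ∈ A → t ≤ ‖f x‖)
    (h : eLpNorm f (ENNReal.ofReal s) m ≤ ENNReal.ofReal N) : t * m.real A ^ (1 / s) ≤ N := by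
  have h1 := mul_meas_ge_le_pow_eLpNorm' m (ENNReal.ofReal_pos.2 hs).ne' ENNReal.ofReal_ne_top hf
    (ENNReal.ofReal t)
  rw [ENNReal.toReal_ofReal hs.le] at h1
  have h2 : m A ≤ m {x | ENNReal.ofReal t ≤ ‖f x‖ₑ} := by
    refine measure_mono_ae ?_
    filter_upwards [hA] with x hx hxA
    change ENNReal.ofReal t ≤ ‖f x‖ₑ
    rw [← ofReal_norm]
    exact ENNReal.ofReal_le_ofReal (hx hxA)
  have h3 : ENNReal.ofReal (t ^ s * m.real A) ≤ ENNReal.ofReal (N ^ s) := by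
    rw [ENNReal.ofReal_mul (by positivity), ofReal_measureReal,
      ← ENNReal.ofReal_rpow_of_nonneg ht hs.le, ← ENNReal.ofReal_rpow_of_nonneg hN hs.le]
    calc _ ≤ _ := mul_le_mul' le_rfl h2
      _ ≤ _ := h1
      _ ≤ _ := by gcongr
  rw [ENNReal.ofReal_le_ofReal_iff (by positivity)] at h3
  have h4 := Real.rpow_le_rpow (by positivity) h3 (one_div_nonneg.2 hs.le)
  rwa [Real.mul_rpow (by positivity) measureReal_nonneg, ← Real.rpow_mul ht, ← Real.rpow_mul hN,
    mul_one_div_cancel hs.ne', Real.rpow_one, Real.rpow_one] at h4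

/-! ### Stampacchia's one-sided bound -/

namespace SobolevW1

variable {d : ℕ} {Ω : Set (EuclideanSpace ℝ (Fin d))}
  {μ : EuclideanSpace ℝ (Fin d) → Matrix (Fin d) (Fin d) ℝ}

/-- Stampacchia's estimate: an upper bound for the real part of `u` in terms of `‖u‖` and a bound
for the functional `𝒜 u` on `W^{1,p}(Ω)`. -/
theorem exists_ae_re_le (hΩ : IsOpen Ω) (hne : Ω.Nonempty) (hfin : volume Ω ≠ ⊤)
    {r : ℝ} (hr : 2 < r)
    (hemb : ∀ u : SobolevW1 Ω 2, MemLp u.fn (ENNReal.ofReal r) (volume.restrict Ω))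
    (hμ_meas : ∀ k l, AEMeasurable (fun x => μ x k l) (volume.restrict Ω))
    (hμ_bdd : ∃ M : ℝ, ∀ᵐ x ∂(volume.restrict Ω), ∀ k l, |μ x k l| ≤ M) {ν : ℝ} (hν0 : 0 < ν)
    (hν : ∀ᵐ x ∂(volume.restrict Ω), ∀ ξ : Fin d → ℂ,
      ν * ∑ k, ‖ξ k‖ ^ 2 ≤ (∑ k, ∑ l, (μ x k l : ℂ) * ξ k * conj (ξ l)).re)
    {p : ℝ≥0∞} [Fact (1 ≤ p)] (hp : p ≤ 2) (hpr : 1 / r < 1 / p.toReal - 1 / 2) :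
    ∃ c : ℝ, 0 < c ∧ ∀ (N : ℝ) (u : SobolevW1 Ω 2), 0 < N →
      (∀ v : SobolevW1 Ω 2, (neumannForm μ u v).re ≤ N * ‖incl hfin hp v‖) →
      ∀ᵐ x ∂volume.restrict Ω, (u.fn x).re ≤ c * (‖u‖ + N) := by
  have : Fact (1 ≤ ENNReal.ofReal r) :=
    ⟨by rw [← ENNReal.ofReal_one]; exact ENNReal.ofReal_le_ofReal (by linarith)⟩
  have : IsFiniteMeasure (volume.restrict Ω) := isFiniteMeasure_restrict.2 hfin
  have hr0 : 0 < r := by linarith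
  obtain ⟨S, hS, hSob⟩ := exists_eLpNorm_le hemb
  set m := volume.restrict Ω with hm
  set β := 1 / p.toReal - 1 / 2 with hβ
  have hβ0 : 0 < β := (by positivity : 0 < 1 / r).trans hpr
  have hα : 0 < 1 / 2 - 1 / r := sub_pos.2 (one_div_lt_one_div_of_lt two_pos hr)
  -- The measure threshold below which Hölder and the embedding give $\|v\|_2 \le
  -- \frac12\|v\|_{W^{1,2}}$ for functions $v$ vanishing off the set.
  set δ : ℝ := (1 / (2 * S)) ^ (1 / (1 / 2 - 1 / r)) with hδ
  have hδ0 : 0 < δ := by positivity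
  have hV : 0 < m.real univ := by
    rw [measureReal_def, Measure.restrict_apply_univ]
    exact ENNReal.toReal_pos (hΩ.measure_pos volume hne).ne' hfin
  set B := m.real univ ^ (1 / r) with hB
  have hB0 : 0 < B := by positivity
  set γ := β * r with hγdef
  have hγ : 1 < γ := by
    have := mul_lt_mul_of_pos_right hpr hr0
    rwa [one_div_mul_cancel hr0.ne'] at this
  -- The rise in the iteration lemma divided by `N`. It is independent of `u`, since `B` bounds
  -- $|A_k|^{1/r}$ by the measure of $\Omega$ alone.
  set P := 2 * (S * (2 * (d + 1) / ν)) * B ^ (γ - 1) * 2 ^ (1 / (γ - 1)) with hP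
  have hP0 : 0 < P := by positivity
  refine ⟨1 / √δ + P, by positivity, fun N u hN hu => ?_⟩
  set A : ℝ → Set (EuclideanSpace ℝ (Fin d)) := fun k => {x | k < (u.fn x).re} with hA
  have hAm : ∀ k, MeasurableSet (A k) := fun k =>
    measurableSet_lt measurable_const
      (Complex.measurable_re.comp (Lp.stronglyMeasurable u.fn).measurable)
  have hAanti : Antitone fun k => m.real (A k) := fun k h hkh =>
    measureReal_mono fun x (hx : h < _) => lt_of_le_of_lt hkh hx
  -- By Chebyshev in $L^2$, $k_0 |A_{k_0}|^{1/2} \le \|u\|_2 \le k_0\sqrt\delta$. The summand `N`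
  -- keeps $k_0$ positive when $u = 0$.
  set k₀ := (‖u‖ + N) / √δ with hk₀
  have hk₀0 : 0 < k₀ := by positivity
  have hsmall : m.real (A k₀) ≤ δ := by
    have h1 := mul_measureReal_rpow_le_of_eLpNorm_le (m := m) (f := u.fn) (Lp.memLp u.fn).1
      (s := 2) two_pos hk₀0.le (norm_nonneg u.fn) (A := A k₀)
      (Eventually.of_forall fun x (hx : k₀ < _) => hx.le.trans (Complex.re_le_norm _))
      (by rw [ofReal_norm, Lp.enorm_def, ENNReal.ofReal_ofNat])
    have h2 : k₀ * m.real (A k₀) ^ (1 / 2 : ℝ) ≤ k₀ * √δ := by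
      calc _ ≤ ‖u.fn‖ := h1
        _ ≤ ‖u‖ + N := (norm_fn_le u).trans (by linarith)
        _ = k₀ * √δ := by rw [hk₀, div_mul_cancel₀ _ (by positivity)]
    have h3 := le_of_mul_le_mul_left h2 hk₀0
    rw [← Real.sqrt_eq_rpow] at h3
    exact (Real.sqrt_le_sqrt_iff hδ0.le).1 h3
  -- the energy estimate for the truncations
  have htrunc : ∀ k, k₀ ≤ k → ∃ v : SobolevW1 Ω 2,
      (∀ᵐ x ∂m, v.fn x = ((max ((u.fn x).re - k) 0 : ℝ) : ℂ)) ∧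
      ‖v‖ ≤ 2 * (d + 1) / ν * N * m.real (A k) ^ β := by
    intro k hk
    obtain ⟨v, hvfn, hvg⟩ := exists_truncation hΩ u (hk₀0.le.trans hk)
    refine ⟨v, hvfn, ?_⟩
    have hv0 : ∀ᵐ x ∂m, x ∉ A k → v.fn x = 0 := by
      filter_upwards [hvfn] with x hx hxA
      rw [hx, max_eq_right (by simpa [hA] using hxA), Complex.ofReal_zero]
    have hg0 : ∀ j, ∀ᵐ x ∂m, x ∉ A k → v.grad j x = 0 := by
      intro j
      filter_upwards [hvg j] with x hx hxA
      rw [hx]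
      exact if_neg hxA
    have h1 : ν * energy v ≤ N * ((d + 1) * m.real (A k) ^ β * ‖v‖) :=
      (mul_energy_le_re_neumannForm_truncation hμ_meas hμ_bdd hν hvg).trans ((hu v).trans
        (mul_le_mul_of_nonneg_left (norm_incl_le hfin hp v (hAm k) hv0 hg0) hN.le))
    have h2 : ‖v.fn‖ ≤ 1 / 2 * ‖v‖ := by
      have h := eLpNorm_le_of_ae_eq_zero_off (p := 2) (s := ENNReal.ofReal r) one_le_two
        ENNReal.ofReal_ne_top (by
          rw [show (2 : ℝ≥0∞) = ENNReal.ofReal 2 by simp]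
          exact ENNReal.ofReal_le_ofReal hr.le) (Lp.memLp v.fn).1 (hAm k) hv0
      rw [ENNReal.toReal_ofReal hr0.le, ENNReal.toReal_ofNat] at h
      have h' : m.real (A k) ^ (1 / 2 - 1 / r) ≤ 1 / (2 * S) := by
        calc _ ≤ δ ^ (1 / 2 - 1 / r) :=
              Real.rpow_le_rpow measureReal_nonneg ((hAanti hk).trans hsmall) hα.le
          _ = _ := by
            rw [hδ, ← Real.rpow_mul (by positivity), one_div_mul_cancel hα.ne', Real.rpow_one]
      have h'' : ENNReal.ofReal ‖v.fn‖ ≤ ENNReal.ofReal (1 / 2 * ‖v‖) := by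
        rw [ofReal_norm, Lp.enorm_def]
        calc _ ≤ _ := h
          _ ≤ ENNReal.ofReal (S * ‖v‖) * ENNReal.ofReal (1 / (2 * S)) :=
            mul_le_mul' (hSob v) (ENNReal.ofReal_le_ofReal h')
          _ = _ := by
            rw [← ENNReal.ofReal_mul (by positivity)]
            congr 1
            field_simp
      rwa [ENNReal.ofReal_le_ofReal_iff (by positivity)] at h''
    -- The $L^2$ part is at most a quarter of the squared norm, so the energy dominates without
    -- Poincaré's inequality.
    have h3 : ‖v‖ ^ 2 ≤ 2 * energy v := by
      have h4 : ‖v‖ ^ 2 = ‖v.fn‖ ^ 2 + energy v := norm_sq v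
      have h5 : ‖v.fn‖ ^ 2 ≤ (1 / 2 * ‖v‖) ^ 2 := by gcongr
      nlinarith [sq_nonneg ‖v‖]
    rcases (norm_nonneg v).eq_or_lt with h | h
    · rw [← h]; positivity
    · refine le_of_mul_le_mul_right ?_ h
      calc ‖v‖ * ‖v‖ = ‖v‖ ^ 2 := by ring
        _ ≤ 2 * energy v := h3
        _ = 2 / ν * (ν * energy v) := by field_simp
        _ ≤ 2 / ν * (N * ((d + 1) * m.real (A k) ^ β * ‖v‖)) := by gcongr
        _ = _ := by ring
  -- On $A_h$ the truncation at level $k$ is at least $h - k$, so Chebyshev in $L^r$ applies. In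
  -- terms of $b(k) = |A_k|^{1/r}$ the power $|A_k|^\beta$ is $b(k)^{\gamma}$ with $\gamma = \beta r
  -- > 1$.
  have hiter : ∀ k h, k₀ ≤ k → k < h → (h - k) * m.real (A h) ^ (1 / r)
      ≤ S * (2 * (d + 1) / ν) * N * (m.real (A k) ^ (1 / r)) ^ γ := by
    intro k h hk hkh
    obtain ⟨v, hvfn, hv⟩ := htrunc k hk
    have h1 := mul_measureReal_rpow_le_of_eLpNorm_le (m := m) (f := v.fn) (Lp.memLp v.fn).1
      hr0 (sub_pos.2 hkh).le (by positivity) (A := A h) (by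
        filter_upwards [hvfn] with x hx hxA
        have hxA' : h < (u.fn x).re := hxA
        rw [hx, Complex.norm_real, Real.norm_of_nonneg (le_max_right _ _)]
        exact le_max_of_le_left (by linarith)) (hSob v)
    refine h1.trans ((mul_le_mul_of_nonneg_left hv hS.le).trans (le_of_eq ?_))
    rw [← Real.rpow_mul measureReal_nonneg, hγdef,
      show 1 / r * (β * r) = β by field_simp]
    ring
  have hzero := eq_zero_of_stampacchia (b := fun k => m.real (A k) ^ (1 / r))
    (fun k => by positivity)
    (fun k h hkh => Real.rpow_le_rpow measureReal_nonneg (hAanti hkh) (by positivity))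
    (k₀ := k₀) (M := S * (2 * (d + 1) / ν) * N) (by positivity) hB0 hγ
    (Real.rpow_le_rpow measureReal_nonneg (measureReal_mono (subset_univ _)) (by positivity)) hiter
  rw [Real.rpow_eq_zero measureReal_nonneg (by positivity), measureReal_eq_zero_iff] at hzero
  have hae : ∀ᵐ x ∂m, x ∉ A (k₀ + 2 * (S * (2 * (d + 1) / ν) * N) * B ^ (γ - 1)
      * 2 ^ (1 / (γ - 1))) := measure_eq_zero_iff_ae_notMem.1 hzero
  filter_upwards [hae] with x hx
  refine (not_lt.1 hx).trans ?_
  have e1 : 2 * (S * (2 * (d + 1) / ν) * N) * B ^ (γ - 1) * 2 ^ (1 / (γ - 1)) = P * N := by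
    rw [hP]; ring
  rw [e1, hk₀]
  have : 0 ≤ P * ‖u‖ := by positivity
  calc _ ≤ (‖u‖ + N) / √δ + P * N + P * ‖u‖ := by linarith
    _ = _ := by ring

end SobolevW1

/-! ### Supremum bound, solvability, uniqueness and energy estimate -/

namespace SobolevW1

variable {d : ℕ} {Ω : Set (EuclideanSpace ℝ (Fin d))}
  {μ : EuclideanSpace ℝ (Fin d) → Matrix (Fin d) (Fin d) ℝ}

lemma neumannForm_smul_left
    (hμ_meas : ∀ k l, AEMeasurable (fun x => μ x k l) (volume.restrict Ω))
    (hμ_bdd : ∃ M : ℝ, ∀ᵐ x ∂(volume.restrict Ω), ∀ k l, |μ x k l| ≤ M) (a : ℂ)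
    (u v : SobolevW1 Ω 2) : neumannForm μ (a • u) v = a * neumannForm μ u v := by
  obtain ⟨B, hB⟩ := (exists_sesqForm hμ_meas hμ_bdd).2
  exact map_smul_left_of_apply_eq_conj B hB a u v

lemma neumannForm_sub_left
    (hμ_meas : ∀ k l, AEMeasurable (fun x => μ x k l) (volume.restrict Ω))
    (hμ_bdd : ∃ M : ℝ, ∀ᵐ x ∂(volume.restrict Ω), ∀ k l, |μ x k l| ≤ M)
    (u u' v : SobolevW1 Ω 2) :
    neumannForm μ (u - u') v = neumannForm μ u v - neumannForm μ u' v := by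
  obtain ⟨B, hB⟩ := (exists_sesqForm hμ_meas hμ_bdd).2
  exact map_sub_left_of_apply_eq_conj B hB u u' v

lemma neumannForm_one_right (hfin : volume Ω ≠ ⊤) (u : SobolevW1 Ω 2) :
    neumannForm μ u (one hfin) = 0 := by
  refine integral_eq_zero_of_ae ?_
  filter_upwards [Lp.coeFn_zero ℂ 2 (volume.restrict Ω)] with x hx
  simp only [one_grad, hx]
  simp

/-- The `L^∞` bound in terms of `‖u‖` and a bound for the functional `𝒜 u` on `W^{1,p}(Ω)`. -/
theorem exists_eLpNorm_top_le (hΩ : IsOpen Ω) (hne : Ω.Nonempty) (hfin : volume Ω ≠ ⊤)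
    {r : ℝ} (hr : 2 < r)
    (hemb : ∀ u : SobolevW1 Ω 2, MemLp u.fn (ENNReal.ofReal r) (volume.restrict Ω))
    (hμ_meas : ∀ k l, AEMeasurable (fun x => μ x k l) (volume.restrict Ω))
    (hμ_bdd : ∃ M : ℝ, ∀ᵐ x ∂(volume.restrict Ω), ∀ k l, |μ x k l| ≤ M) {ν : ℝ} (hν0 : 0 < ν)
    (hν : ∀ᵐ x ∂(volume.restrict Ω), ∀ ξ : Fin d → ℂ,
      ν * ∑ k, ‖ξ k‖ ^ 2 ≤ (∑ k, ∑ l, (μ x k l : ℂ) * ξ k * conj (ξ l)).re)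
    {p : ℝ≥0∞} [Fact (1 ≤ p)] (hp : p ≤ 2) (hpr : 1 / r < 1 / p.toReal - 1 / 2) :
    ∃ c : ℝ, 0 < c ∧ ∀ (T : SobolevDual Ω p) (u : SobolevW1 Ω 2), SolvesNeumann hfin hp μ u T →
      ∀ N, ‖T‖ < N → eLpNorm u.fn ⊤ (volume.restrict Ω) ≤ ENNReal.ofReal (c * (‖u‖ + N)) := by
  obtain ⟨c, hc, h⟩ := exists_ae_re_le hΩ hne hfin hr hemb hμ_meas hμ_bdd hν0 hν hp hpr
  -- The factor `2` is the price of $|z| \le |\operatorname{Re} z| + |\operatorname{Im} z|$.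
  refine ⟨2 * c, by positivity, fun T u hu N hN => ?_⟩
  -- Multiplying the solution by a unimodular `a` preserves both $\|u\|$ and the bound on the
  -- functional, so the one-sided estimate applies in every direction.
  have hbound : ∀ a : ℂ, ‖a‖ = 1 → ∀ᵐ x ∂volume.restrict Ω, (a * u.fn x).re ≤ c * (‖u‖ + N) := by
    intro a ha
    have h1 := h N (a • u) (T.opNorm_nonneg.trans_lt hN) (fun v => by
      rw [neumannForm_smul_left hμ_meas hμ_bdd, hu v]
      calc _ ≤ ‖a * T (incl hfin hp v)‖ := Complex.re_le_norm _
        _ = ‖T (incl hfin hp v)‖ := by rw [norm_mul, ha, one_mul]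
        _ ≤ ‖T‖ * ‖incl hfin hp v‖ := T.le_opNorm _
        _ ≤ _ := by gcongr)
    rw [norm_smul, ha, one_mul] at h1
    filter_upwards [h1, Lp.coeFn_smul a u.fn] with x hx hx'
    rwa [fn_smul, hx'] at hx
  refine eLpNormEssSup_le_of_ae_bound ?_
  filter_upwards [hbound 1 (by simp), hbound (-1) (by simp), hbound Complex.I (by simp),
    hbound (-Complex.I) (by simp)] with x h1 h2 h3 h4
  simp only [one_mul, neg_mul, Complex.neg_re, Complex.I_mul_re] at h1 h2 h3 h4
  have h5 : |(u.fn x).re| ≤ c * (‖u‖ + N) := abs_le.2 ⟨by linarith, h1⟩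
  have h6 : |(u.fn x).im| ≤ c * (‖u‖ + N) := abs_le.2 ⟨by linarith, by linarith⟩
  linarith [Complex.norm_le_abs_re_add_abs_im (u.fn x)]

lemma one_ne_zero (hΩ : IsOpen Ω) (hne : Ω.Nonempty) (hfin : volume Ω ≠ ⊤) :
    (one hfin : SobolevW1 Ω 2) ≠ 0 := by
  intro h0
  have h : ∀ᵐ x ∂volume.restrict Ω, False := by
    filter_upwards [one_fn_ae (p := 2) hfin, Lp.coeFn_zero ℂ 2 (volume.restrict Ω)] with x h1 h2
    rw [h0] at h1
    exact zero_ne_one (h2.symm.trans h1)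
  rw [eventually_false_iff_eq_bot, ae_eq_bot, Measure.restrict_eq_zero] at h
  exact (hΩ.measure_pos volume hne).ne' h

/-- The integral as a continuous linear functional. -/
noncomputable def integralL (hfin : volume Ω ≠ ⊤) : SobolevW1 Ω 2 →L[ℂ] ℂ :=
  (innerSL ℂ (one hfin : SobolevW1 Ω 2).fn).comp (fnL Ω 2)

lemma integralL_apply (hfin : volume Ω ≠ ⊤) (u : SobolevW1 Ω 2) :
    integralL hfin u = ∫ x in Ω, u.fn x :=
  (integral_fn_eq_inner hfin u.fn).symm

/-- The constant has zero energy, so if its integral vanished, Poincaré's inequality would make it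
zero. -/
lemma integralL_one_ne_zero (hΩ : IsOpen Ω) (hne : Ω.Nonempty) (hfin : volume Ω ≠ ⊤) {C : ℝ}
    (hpoinc : ∀ u : SobolevW1 Ω 2, ‖u‖ ^ 2 ≤ C * (energy u + ‖∫ x in Ω, u.fn x‖ ^ 2)) :
    integralL hfin (one hfin) ≠ 0 := by
  intro h0
  have h1 := hpoinc (one hfin)
  have h2 : energy (one hfin : SobolevW1 Ω 2) = 0 := Finset.sum_eq_zero fun j _ => by
    rw [one_grad, norm_zero, zero_pow two_ne_zero]
  rw [h2, ← integralL_apply hfin, h0, norm_zero, zero_pow two_ne_zero, add_zero, mul_zero] at h1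
  exact one_ne_zero hΩ hne hfin (norm_eq_zero.1 (pow_eq_zero_iff two_ne_zero |>.1
    (le_antisymm h1 (sq_nonneg _))))

lemma _root_.Complex.eq_zero_of_inner_eq_zero {z w : ℂ} (h : inner ℂ z w = 0) (hw : w ≠ 0) :
    z = 0 := by
  simpa [hw] using h

variable {p : ℝ≥0∞} [Fact (1 ≤ p)]

/-- Existence of solutions of mean zero. -/
theorem exists_solvesNeumann (hΩ : IsOpen Ω) (hne : Ω.Nonempty) (hfin : volume Ω ≠ ⊤) (hp : p ≤ 2)
    (hμ_meas : ∀ k l, AEMeasurable (fun x => μ x k l) (volume.restrict Ω))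
    (hμ_bdd : ∃ M : ℝ, ∀ᵐ x ∂(volume.restrict Ω), ∀ k l, |μ x k l| ≤ M) {ν : ℝ} (hν0 : 0 < ν)
    (hcoer : ∀ u : SobolevW1 Ω 2, ν * energy u ≤ (neumannForm μ u u).re) {C : ℝ} (hC : 0 < C)
    (hpoinc : ∀ u : SobolevW1 Ω 2, ‖u‖ ^ 2 ≤ C * (energy u + ‖∫ x in Ω, u.fn x‖ ^ 2))
    (T : SobolevDual Ω p) (hT : T (one hfin) = 0) :
    ∃ u : SobolevW1 Ω 2, (∫ x in Ω, u.fn x) = 0 ∧ SolvesNeumann hfin hp μ u T := by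
  obtain ⟨B, hB⟩ := (exists_sesqForm (Ω := Ω) hμ_meas hμ_bdd).2
  obtain ⟨f, hf⟩ := exists_clm_conj_incl hΩ hfin hp T
  -- `min ν 1` serves both terms at once: the energy carries the weight $\nu$, the integral the
  -- weight $1$.
  have hBm : ∀ v : SobolevW1 Ω 2,
      min ν 1 / C * ‖v‖ ^ 2 ≤ (B v v).re + ‖integralL hfin v‖ ^ 2 := by
    intro v
    rw [hB, Complex.conj_re, integralL_apply]
    have h3 := mul_le_mul_of_nonneg_right (min_le_left ν 1) (energy_nonneg v)
    have h4 := mul_le_mul_of_nonneg_right (min_le_right ν 1) (sq_nonneg ‖∫ x in Ω, v.fn x‖)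
    have h5 : 0 < min ν 1 := lt_min hν0 one_pos
    calc min ν 1 / C * ‖v‖ ^ 2
        ≤ min ν 1 / C * (C * (energy v + ‖∫ x in Ω, v.fn x‖ ^ 2)) := by
          gcongr
          exact hpoinc v
      _ = min ν 1 * energy v + min ν 1 * ‖∫ x in Ω, v.fn x‖ ^ 2 := by
          field_simp
      _ ≤ _ := by linarith [hcoer v]
  obtain ⟨u, hu⟩ := exists_apply_add_inner_eq_of_coercive (V := SobolevW1 Ω 2) B (integralL hfin)
    (div_pos (lt_min hν0 one_pos) hC) hBm f
  have hu' : ∀ v, neumannForm μ u v + conj (inner ℂ (integralL hfin u) (integralL hfin v))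
      = T (incl hfin hp v) := by
    intro v
    have h1 := hu v
    rw [hB, hf] at h1
    apply (starRingEnd ℂ).injective
    rw [map_add (starRingEnd ℂ), Complex.conj_conj, h1]
  -- Testing with $\mathbf 1$ annihilates the form and, by the compatibility condition, the
  -- right-hand side; only the added term remains.
  have hmu : integralL hfin u = 0 := by
    have h1 := hu' (one hfin)
    rw [neumannForm_one_right, incl_one hΩ, hT, zero_add] at h1
    exact Complex.eq_zero_of_inner_eq_zero ((map_eq_zero (starRingEnd ℂ)).1 h1)
      (integralL_one_ne_zero hΩ hne hfin hpoinc)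
  refine ⟨u, by rw [← integralL_apply hfin, hmu], fun v => ?_⟩
  rw [← hu' v, hmu, inner_zero_left, map_zero (starRingEnd ℂ), add_zero]

/-- Solutions of mean zero are unique. -/
theorem solvesNeumann_unique (hfin : volume Ω ≠ ⊤) (hp : p ≤ 2)
    (hμ_meas : ∀ k l, AEMeasurable (fun x => μ x k l) (volume.restrict Ω))
    (hμ_bdd : ∃ M : ℝ, ∀ᵐ x ∂(volume.restrict Ω), ∀ k l, |μ x k l| ≤ M) {ν : ℝ} (hν0 : 0 < ν)
    (hcoer : ∀ u : SobolevW1 Ω 2, ν * energy u ≤ (neumannForm μ u u).re) {C : ℝ} (hC : 0 < C)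
    (hpoinc : ∀ u : SobolevW1 Ω 2, ‖u‖ ^ 2 ≤ C * (energy u + ‖∫ x in Ω, u.fn x‖ ^ 2))
    {T : SobolevDual Ω p} {u u' : SobolevW1 Ω 2} (hu0 : (∫ x in Ω, u.fn x) = 0)
    (hu : SolvesNeumann hfin hp μ u T) (hu'0 : (∫ x in Ω, u'.fn x) = 0)
    (hu' : SolvesNeumann hfin hp μ u' T) : u' = u := by
  set w := u' - u with hw
  have h1 : ∫ x in Ω, w.fn x = 0 := by
    rw [← integralL_apply hfin, hw, map_sub (integralL hfin), integralL_apply, integralL_apply, hu0,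
      hu'0, sub_zero]
  have h2 : neumannForm μ w w = 0 := by
    rw [hw, neumannForm_sub_left hμ_meas hμ_bdd, hu', hu, sub_self]
  have h3 := hcoer w
  rw [h2, Complex.zero_re] at h3
  have h4 : energy w ≤ 0 := by
    by_contra h
    exact absurd h3 (not_le.2 (mul_pos hν0 (not_le.1 h)))
  have h5 := hpoinc w
  rw [h1, norm_zero, zero_pow two_ne_zero, add_zero] at h5
  have h6 : ‖w‖ ^ 2 ≤ 0 := h5.trans (mul_nonpos_of_nonneg_of_nonpos hC.le h4)
  exact sub_eq_zero.1 (norm_eq_zero.1 (pow_eq_zero_iff two_ne_zero |>.1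
    (le_antisymm h6 (sq_nonneg _))))

/-- The energy estimate for solutions of mean zero. -/
theorem norm_le_of_solvesNeumann (hfin : volume Ω ≠ ⊤) (hp : p ≤ 2) {ν : ℝ} (hν0 : 0 < ν)
    (hcoer : ∀ u : SobolevW1 Ω 2, ν * energy u ≤ (neumannForm μ u u).re) {C : ℝ} (hC : 0 < C)
    (hpoinc : ∀ u : SobolevW1 Ω 2, ‖u‖ ^ 2 ≤ C * (energy u + ‖∫ x in Ω, u.fn x‖ ^ 2)) {C' : ℝ}
    (hC' : 0 < C') (hincl : ∀ u : SobolevW1 Ω 2, ‖incl hfin hp u‖ ≤ C' * ‖u‖)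
    {T : SobolevDual Ω p} {u : SobolevW1 Ω 2} (hu0 : (∫ x in Ω, u.fn x) = 0)
    (hu : SolvesNeumann hfin hp μ u T) : ‖u‖ ≤ C * C' / ν * ‖T‖ := by
  have hT := T.opNorm_nonneg
  rcases (norm_nonneg u).eq_or_lt with h | h
  · rw [← h]; positivity
  · refine le_of_mul_le_mul_right ?_ h
    have h1 := hpoinc u
    rw [hu0, norm_zero, zero_pow two_ne_zero, add_zero] at h1
    have h2 : ν * energy u ≤ ‖T‖ * (C' * ‖u‖) := by
      refine (hcoer u).trans ((Complex.re_le_norm _).trans ?_)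
      rw [hu u]
      exact (T.le_opNorm _).trans (mul_le_mul_of_nonneg_left (hincl u) hT)
    calc ‖u‖ * ‖u‖ = ‖u‖ ^ 2 := by ring
      _ ≤ C * energy u := h1
      _ = C / ν * (ν * energy u) := by field_simp
      _ ≤ C / ν * (‖T‖ * (C' * ‖u‖)) := by gcongr
      _ = _ := by ring

end SobolevW1

/-! ### The theorem -/

theorem theorem1p1 {d : ℕ} (Ω : Set (EuclideanSpace ℝ (Fin d)))
    (hΩ_open : IsOpen Ω) (hΩ_bdd : Bornology.IsBounded Ω) (hΩ_conn : IsConnected Ω)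
    (r : ℝ) (hr : 2 < r)
    (hemb : ∀ u : SobolevW1 Ω 2, MemLp u.fn (ENNReal.ofReal r) (volume.restrict Ω))
    (μ : EuclideanSpace ℝ (Fin d) → Matrix (Fin d) (Fin d) ℝ)
    (hμ_meas : ∀ k l, AEMeasurable (fun x => μ x k l) (volume.restrict Ω))
    (hμ_bdd : ∃ M : ℝ, ∀ᵐ x ∂(volume.restrict Ω), ∀ k l, |μ x k l| ≤ M)
    (hμ_ell : ∃ ν : ℝ, 0 < ν ∧ ∀ᵐ x ∂(volume.restrict Ω), ∀ ξ : Fin d → ℂ,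
      ν * ∑ k, ‖ξ k‖ ^ 2 ≤ (∑ k, ∑ l, (μ x k l : ℂ) * ξ k * conj (ξ l)).re)
    (q : ℝ) (hq : (d : ℝ) < q) (hqr : 1 / 2 - 1 / q > 1 / r)
    (p : ℝ) (hpq : p.HolderConjugate q) [Fact (1 ≤ ENNReal.ofReal p)] :
    -- every `u` with `𝒜 u` in the antidual of `W^{1,p}` is bounded
    (∀ u : SobolevW1 Ω 2,
      (∃ T : SobolevDual Ω (ENNReal.ofReal p),
        SolvesNeumann hΩ_bdd.measure_lt_top.ne (dualExponent_le_two hr hpq hqr) μ u T) →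
      MemLp u.fn ⊤ (volume.restrict Ω)) ∧
    -- unique mean-zero solvability
    (∀ T : SobolevDual Ω (ENNReal.ofReal p),
      T (SobolevW1.one hΩ_bdd.measure_lt_top.ne) = 0 →
      ∃! u : SobolevW1 Ω 2, (∫ x in Ω, u.fn x) = 0 ∧
        SolvesNeumann hΩ_bdd.measure_lt_top.ne (dualExponent_le_two hr hpq hqr) μ u T) ∧
    -- the estimate, with a constant independent of `T`
    (∃ c : ℝ, 0 < c ∧ ∀ T : SobolevDual Ω (ENNReal.ofReal p),
      T (SobolevW1.one hΩ_bdd.measure_lt_top.ne) = 0 →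
      ∀ u : SobolevW1 Ω 2, (∫ x in Ω, u.fn x) = 0 →
        SolvesNeumann hΩ_bdd.measure_lt_top.ne (dualExponent_le_two hr hpq hqr) μ u T →
        eLpNorm u.fn ⊤ (volume.restrict Ω) ≤ ENNReal.ofReal (c * ‖T‖)) := by
  obtain ⟨ν, hν0, hν⟩ := hμ_ell
  have hfin : volume Ω ≠ ⊤ := hΩ_bdd.measure_lt_top.ne
  have hp := dualExponent_le_two hr hpq hqr
  -- Duality of the exponents gives $\frac1p - \frac12 = \frac12 - \frac1q$, so this is the
  -- assumption on $q$ and $r$.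
  have hpr : 1 / r < 1 / (ENNReal.ofReal p).toReal - 1 / 2 := by
    rw [ENNReal.toReal_ofReal hpq.nonneg, one_div p]
    have := hpq.inv_add_inv_eq_one
    rw [one_div q] at hqr
    linarith
  obtain ⟨c₁, hc₁, hsup⟩ := SobolevW1.exists_eLpNorm_top_le hΩ_open hΩ_conn.nonempty hfin hr hemb
    hμ_meas hμ_bdd hν0 hν hp hpr
  obtain ⟨c₂, hc₂, hpoinc⟩ := SobolevW1.exists_norm_le_energy_add_integral hΩ_open hΩ_conn hfin hr
    hemb
  obtain ⟨c₃, hc₃, hincl⟩ := SobolevW1.exists_norm_incl_le (Ω := Ω) hfin hp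
  have hcoer := SobolevW1.mul_energy_le_re_neumannForm_self hμ_meas hμ_bdd hν
  refine ⟨?_, ?_, ?_⟩
  · rintro u ⟨T, hT⟩
    exact ⟨(Lp.memLp u.fn).1, (hsup T u hT (‖T‖ + 1) (by linarith)).trans_lt ENNReal.ofReal_lt_top⟩
  · intro T hT1
    obtain ⟨u, hu0, hu⟩ := SobolevW1.exists_solvesNeumann hΩ_open hΩ_conn.nonempty hfin hp hμ_meas
      hμ_bdd hν0 hcoer hc₂ hpoinc T hT1
    exact ⟨u, ⟨hu0, hu⟩, fun u' hu' => SobolevW1.solvesNeumann_unique hfin hp hμ_meas hμ_bdd hν0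
      hcoer hc₂ hpoinc hu0 hu hu'.1 hu'.2⟩
  · refine ⟨c₁ * (c₂ * c₃ / ν + 1), by positivity, fun T _ u hu0 hu => ?_⟩
    have hnorm : ‖u‖ ≤ c₂ * c₃ / ν * ‖T‖ :=
      SobolevW1.norm_le_of_solvesNeumann hfin hp hν0 hcoer hc₂ hpoinc hc₃ hincl hu0 hu
    -- The supremum bound needs $N > \|T\|$ strictly, which covers $T = 0$; letting $N \downarrow
    -- \|T\|$ makes it homogeneous in $T$.
    have hlim : Tendsto (fun N => ENNReal.ofReal (c₁ * (‖u‖ + N))) (𝓝[>] ‖T‖)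
        (𝓝 (ENNReal.ofReal (c₁ * (‖u‖ + ‖T‖)))) := by
      refine Tendsto.mono_left (Continuous.tendsto ?_ _) nhdsWithin_le_nhds
      exact ENNReal.continuous_ofReal.comp (by fun_prop)
    have hle : eLpNorm u.fn ⊤ (volume.restrict Ω) ≤ ENNReal.ofReal (c₁ * (‖u‖ + ‖T‖)) := by
      refine ge_of_tendsto hlim ?_
      filter_upwards [self_mem_nhdsWithin] with N hN using hsup T u hu N hN
    refine hle.trans (ENNReal.ofReal_le_ofReal ?_)
    calc c₁ * (‖u‖ + ‖T‖) ≤ c₁ * (c₂ * c₃ / ν * ‖T‖ + ‖T‖) := by gcongr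
      _ = _ := by ring
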